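/- Write $\mathbb{T}=\mathbb{R}/2\pi\mathbb{Z}$, $\mathbb{Z}_0=\mathbb{Z}\setminus\{0\}$, $f_k=\frac1{2\pi}\int_{\mathbb{T}} f(x)e^{-ikx}\,dx$. Let $(s,p)\in\mathbb{R}^2$ satisfy either (i) $s>\frac12-\frac1p$, $p>2$, or (ii) $s\ge 0$, $p=2$. For real $r$ let $\mathcal{F}L^{r,p}_0(\mathbb{T})$ be the space of mean-zero functions $f$ on $\mathbb{T}$ with $\|f\|_{\mathcal{F}L^{r,p}_0}=\big\||k|^{r}f_k\big\|_{\ell^p(\mathbb{Z}_0)}<\infty$ (for $r\ge s$ it is contained in $L^2(\mathbb{T})$). For mean-zero $v$, $t\in\mathbb{R}$, $k\in\mathbb{Z}_0$ and $n\ge1$, let $$\mathcal{N}^n_k(t)(v)=\frac{(-1)^n k}{2^{n-1}n!}\sum_{\substack{k_1,\dots,k_n\in\mathbb{Z}_0\\ k_1+\dots+k_n=k}}e^{i\Phi_n t}\prod_{j=1}^n\frac{v_{k_j}}{k_j},\qquad \Phi_n=\Big(\sum_{j=1}^n k_j\Big)^2-\sum_{j=1}^n k_j^2,$$ so that $\mathcal{N}^1(t)(v)=-v$,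 and for $n\ge2$ let $$\mathcal{R}^n_k(t)(v)=-\frac i4\,\Big(\sum_{m\in\mathbb{Z}_0}e^{-2im^2t}v_mv_{-m}\Big)\,\mathcal{N}^{n-1}_k(t)(v).$$ The normal form equation with initial datum $\phi$ is $$v(t)=\phi+\sum_{n=2}^\infty\mathcal{N}^n(t)(v(t))-\sum_{n=2}^\infty\mathcal{N}^n(0)(\phi)+\int_0^t\sum_{n=2}^\infty\mathcal{R}^n(t')(v(t'))\,dt'.\tag{NF}$$ A solution of (NF) in $C([0,T];\mathcal{F}L^{s,p}_0(\mathbb{T}))$ is a $v$ in this space with $v|_{t=0}=\phi$ for which the multiple sums over frequencies above converge absolutely, the two series in $n$ converge absolutely in $\mathcal{F}L^{s,p}_0$ at every $t\in[0,T]$, the time integrand is integrable in $\mathcal{F}L^{s,p}_0$ on $[0,T]$, and (NF) holds for all $t\in[0,T]$. **Proposition.** There exist $\delta_1=\delta_1(s,p)>0$ and a function $T:\mathbb{R}\to(0,\infty)$, depending only on $(s,p)$, such that: 1. (Local well-posedness.) For every $\phi\in\mathcal{F}L^{s,p}_0(\mathbb{T})$ with $\|\phi\|_{\mathcal{F}L^{s,p}_0}\le\delta_1$,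 setting $T=T(\|\phi\|_{\mathcal{F}L^{s,p}_0})$, there is a unique solution $v$ of (NF) in $C([0,T];\mathcal{F}L^{s,p}_0(\mathbb{T}))$ with $v|_{t=0}=\phi$. 2. (Persistence of regularity.) For every $\sigma>0$ there are $\delta\in(0,\delta_1]$ and a function $T':\mathbb{R}\to(0,\infty)$ with $T'\le T$, both depending only on $(s,p,\sigma)$, such that if $\phi\in\mathcal{F}L^{s+\sigma,p}_0(\mathbb{T})$ and $\|\phi\|_{\mathcal{F}L^{s,p}_0}\le\delta$, then the solution $v$ of part 1 satisfies $v(t)\in\mathcal{F}L^{s+\sigma,p}_0(\mathbb{T})$ and $\|v(t)\|_{\mathcal{F}L^{s+\sigma,p}_0}\le\frac52\|\phi\|_{\mathcal{F}L^{s+\sigma,p}_0}$ for all $0\le t\le T'(\|\phi\|_{\mathcal{F}L^{s,p}_0})$. -/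

import Mathlib

noncomputable section

namespace NormalForm

open MeasureTheory Set Filter Topology
open scoped ENNReal

instance fact_two_pi_pos : Fact (0 < 2 * Real.pi) := ⟨Real.two_pi_pos⟩

/-- The space `L²(𝕋)` of complex-valued functions on `𝕋 = ℝ / 2πℤ`
(with respect to `dx / 2π`). -/
abbrev L2Torus : Type :=
  Lp ℂ 2 (AddCircle.haarAddCircle : Measure (AddCircle (2 * Real.pi)))

/-- The Fourier coefficients `f_k = (1 / 2π) ∫ f(x) e^{-ikx} dx`. -/
def coeff (f : L2Torus) (k : ℤ) : ℂ := fourierCoeff (f : AddCircle (2 * Real.pi) → ℂ) k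

/-- The nonzero frequencies `ℤ₀ = ℤ \ {0}`. -/
abbrev ZNonzero : Type := {k : ℤ // k ≠ 0}

/-- The Fourier-Lebesgue norm `‖ |k|^s a_k ‖_{ℓ^p(ℤ₀)}` of a family of Fourier coefficients,
with values in `[0, ∞]`; only the coefficients at nonzero frequencies enter. -/
def flNorm (s p : ℝ) (a : ℤ → ℂ) : ℝ≥0∞ :=
  (∑' k : ZNonzero, (ENNReal.ofReal (|((k : ℤ) : ℝ)| ^ s) * ‖a k‖ₑ) ^ p) ^ (1 / p)

/-- The Fourier-Lebesgue space `FL₀^{s,p}(𝕋)` of mean-zero functions with finite norm.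
It is used only for exponents for which it embeds into `L²(𝕋)`, so that its elements may be taken
in `L²(𝕋)` from the start. -/
def FL (s p : ℝ) : Set L2Torus :=
  {f | coeff f 0 = 0 ∧ flNorm s p (coeff f) < ∞}

/-- `v` belongs to `C([0, T]; FL₀^{s,p}(𝕋))`. -/
def IsContinuousFL (s p T : ℝ) (v : ℝ → L2Torus) : Prop :=
  (∀ t ∈ Icc 0 T, v t ∈ FL s p) ∧
    ∀ t₀ ∈ Icc 0 T,
      Tendsto (fun t => flNorm s p (coeff (v t - v t₀))) (𝓝[Icc 0 T] t₀) (𝓝 0)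

/-- The `n`-tuples `(k₁, …, k_n)` of nonzero frequencies with `k₁ + ⋯ + k_n = m`. -/
abbrev Freq (n : ℕ) (m : ℤ) : Type :=
  {k : Fin n → ℤ // (∀ j, k j ≠ 0) ∧ ∑ j, k j = m}

/-- The modulation function `Φ_n(k) = (∑ k_j)² - ∑ k_j²`. -/
def modulation {n : ℕ} (k : Fin n → ℤ) : ℤ := (∑ j, k j) ^ 2 - ∑ j, k j ^ 2

/-- The summand `e^{i Φ_n(k) t} ∏_j v_{k_j} / k_j`. -/
def summandN {n : ℕ} (t : ℝ) (a : ℤ → ℂ) (k : Fin n → ℤ) : ℂ :=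
  Complex.exp (Complex.I * (modulation k : ℂ) * (t : ℂ)) * ∏ j, a (k j) / (k j : ℂ)

/-- The `m`-th Fourier coefficient of `𝒩ⁿ(t)(v)`, where `a` are the coefficients of `v`:
`(-1)ⁿ m / (2^{n-1} n!) ∑_{k₁ + ⋯ + k_n = m} e^{i Φ_n(k) t} ∏_j a_{k_j} / k_j`, for `n ≥ 1`.
For `n = 1` this is `-a_m`. -/
def termN (n : ℕ) (t : ℝ) (a : ℤ → ℂ) (m : ℤ) : ℂ :=
  (-1) ^ n * (m : ℂ) / (2 ^ (n - 1) * (n.factorial : ℂ)) * ∑' k : Freq n m, summandN t a k.1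

/-- The summand `e^{-2 i m² t} v_m v_{-m}`. -/
def summandM (t : ℝ) (a : ℤ → ℂ) (m : ℤ) : ℂ :=
  Complex.exp (-2 * Complex.I * (m : ℂ) ^ 2 * (t : ℂ)) * a m * a (-m)

/-- `M(u) = (1 / 2π) ∫ u² dx` for `u = e^{it∂ₓ²} v`, that is
`∑_{m ≠ 0} e^{-2 i m² t} v_m v_{-m}`. -/
def massM (t : ℝ) (a : ℤ → ℂ) : ℂ := ∑' m : ZNonzero, summandM t a m

/-- The `m`-th Fourier coefficient of `ℛⁿ(t)(v) = -(i/4) M(u) 𝒩^{n-1}(t)(v)`, for `n ≥ 2`. -/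
def termR (n : ℕ) (t : ℝ) (a : ℤ → ℂ) (m : ℤ) : ℂ :=
  -(Complex.I / 4) * massM t a * termN (n - 1) t a m

/-- All the series in the normal form equation converge at time `t`, for a function with Fourier
coefficients `a`: the multiple sums defining the coefficients converge absolutely, and the series
`∑_{n ≥ 2} 𝒩ⁿ(t)(v)` and `∑_{n ≥ 2} ℛⁿ(t)(v)` converge absolutely in `FL₀^{s,p}`. -/
structure SeriesConverge (s p t : ℝ) (a : ℤ → ℂ) : Prop where
  summable_summandN : ∀ n : ℕ, 1 ≤ n → ∀ m : ℤ, m ≠ 0 →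
    Summable (fun k : Freq n m => summandN t a k.1)
  summable_summandM : Summable (fun m : ZNonzero => summandM t a m)
  series_termN : ∑' n : ℕ, flNorm s p (termN (n + 2) t a) < ∞
  series_termR : ∑' n : ℕ, flNorm s p (termR (n + 2) t a) < ∞

/-- `v ∈ C([0, T]; FL₀^{s,p})` solves the normal form equation
`v(t) = φ + ∑_{n ≥ 2} 𝒩ⁿ(t)(v(t)) - ∑_{n ≥ 2} 𝒩ⁿ(0)(φ) + ∫₀ᵗ ∑_{n ≥ 2} ℛⁿ(t')(v(t')) dt'`
on `[0, T]` with `v(0) = φ`. The series converge absolutely in `FL₀^{s,p}`, the last integrand is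
integrable with values in `FL₀^{s,p}`, and the equation is an identity of the Fourier coefficients
at all nonzero frequencies. -/
structure IsSolution (s p T : ℝ) (φ : L2Torus) (v : ℝ → L2Torus) : Prop where
  continuous : IsContinuousFL s p T v
  initial : v 0 = φ
  converge : ∀ t ∈ Icc 0 T, SeriesConverge s p t (coeff (v t))
  integrable : ∫⁻ t in Icc 0 T, ∑' n : ℕ, flNorm s p (termR (n + 2) t (coeff (v t))) < ∞
  integrable_coeff : ∀ m : ℤ, m ≠ 0 →
    IntervalIntegrable (fun t => ∑' n : ℕ, termR (n + 2) t (coeff (v t)) m) volume 0 T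
  equation : ∀ t ∈ Icc 0 T, ∀ m : ℤ, m ≠ 0 →
    coeff (v t) m = coeff φ m
      + ∑' n : ℕ, termN (n + 2) t (coeff (v t)) m
      - ∑' n : ℕ, termN (n + 2) 0 (coeff φ) m
      + ∫ t' in (0 : ℝ)..t, ∑' n : ℕ, termR (n + 2) t' (coeff (v t')) m

end NormalForm

end

/-!
For `u = e^{it∂ₓ²} v`, the equation for `v` is the equation for `u` in the interaction picture:
conjugation by the linear flow turns `𝒩ⁿ(t)` and `ℛⁿ(t)` into the time-independent multilinear maps
`𝒩ⁿ(0)` and `ℛⁿ(0)`. Since `|k| |k|^s ≲ ∑_j |k_j| |k_j|^s` for `k = ∑_j k_j`, the factor `k` can be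
moved to one of the `n` frequencies, where it cancels `1/k_j`; the other factors `v_{k_j}/k_j` are
summable because `FL^{s,p}` embeds into `L²`. A Young-type inequality then bounds `𝒩ⁿ` on
`FL^{s,p}`, with constants summable near the origin, so the nonlinearities are analytic there with
vanishing derivative. On a small ball they have Lipschitz constant `1/8`, the equation is a
contraction on `[0, 1]`, and a continuity argument keeps every solution with small datum inside the
ball.

For the persistence of regularity, a solution is not known in advance to lie in `FL^{s+σ,p}`. The
estimates are therefore carried out with the truncated weights `|k|^s min(|k|, N)^σ`, uniformly in
`N`, and `N → ∞` at the end.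
-/

noncomputable section

namespace NormalForm

open MeasureTheory Set Filter Topology
open scoped ENNReal NNReal

/-! ### Weighted sums in `[0, ∞]` -/

section EllNorm

variable {ι κ : Type*} {p q r : ℝ}

/-- The `ℓ^p` norm of a family with values in `[0, ∞]`, in which no summability question arises.
It is used for `p ≥ 1`. -/
def ellNorm (p : ℝ) (f : ι → ℝ≥0∞) : ℝ≥0∞ := (∑' i, f i ^ p) ^ (1 / p)

theorem ellNorm_mono (hp : 0 ≤ p) {f g : ι → ℝ≥0∞} (h : ∀ i, f i ≤ g i) :
    ellNorm p f ≤ ellNorm p g :=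
  ENNReal.rpow_le_rpow (ENNReal.tsum_le_tsum fun i => ENNReal.rpow_le_rpow (h i) hp)
    (by positivity)

theorem ellNorm_zero (hp : 0 < p) : ellNorm p (fun _ : ι => 0) = 0 := by
  simp [ellNorm, hp]

theorem ellNorm_one (f : ι → ℝ≥0∞) : ellNorm 1 f = ∑' i, f i := by
  simp [ellNorm]

theorem ellNorm_rpow (hp : 0 < p) (f : ι → ℝ≥0∞) : ellNorm p f ^ p = ∑' i, f i ^ p := by
  rw [ellNorm, ← ENNReal.rpow_mul, one_div_mul_cancel hp.ne', ENNReal.rpow_one]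

theorem ellNorm_const_mul (hp : 0 < p) (c : ℝ≥0∞) (f : ι → ℝ≥0∞) :
    ellNorm p (fun i => c * f i) = c * ellNorm p f := by
  simp only [ellNorm, ENNReal.mul_rpow_of_nonneg _ _ hp.le, ENNReal.tsum_mul_left]
  rw [ENNReal.mul_rpow_of_nonneg _ _ (by positivity), ← ENNReal.rpow_mul,
    mul_one_div_cancel hp.ne', ENNReal.rpow_one]

theorem le_ellNorm (hp : 0 < p) (f : ι → ℝ≥0∞) (i : ι) : f i ≤ ellNorm p f := by
  rw [← ENNReal.rpow_le_rpow_iff hp, ellNorm_rpow hp]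
  exact ENNReal.le_tsum (f := fun i => f i ^ p) i

theorem ellNorm_le_iff_sum (hp : 0 < p) {f : ι → ℝ≥0∞} {C : ℝ≥0∞} :
    ellNorm p f ≤ C ↔ ∀ u : Finset ι, ∑ i ∈ u, f i ^ p ≤ C ^ p := by
  rw [← ENNReal.rpow_le_rpow_iff hp, ellNorm_rpow hp, ENNReal.tsum_eq_iSup_sum, iSup_le_iff]

theorem ellNorm_eq_lintegral_count [MeasurableSpace ι] [MeasurableSingletonClass ι] (p : ℝ)
    (f : ι → ℝ≥0∞) : ellNorm p f = (∫⁻ i, f i ^ p ∂Measure.count) ^ (1 / p) := by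
  rw [ellNorm, lintegral_count]

theorem ellNorm_add_le (hp : 1 ≤ p) (f g : ι → ℝ≥0∞) :
    ellNorm p (fun i => f i + g i) ≤ ellNorm p f + ellNorm p g := by
  let : MeasurableSpace ι := ⊤
  simp only [ellNorm_eq_lintegral_count]
  exact ENNReal.lintegral_Lp_add_le measurable_from_top.aemeasurable
    measurable_from_top.aemeasurable hp

theorem ellNorm_sum_le (hp : 1 ≤ p) (u : Finset κ) (f : κ → ι → ℝ≥0∞) :
    ellNorm p (fun i => ∑ j ∈ u, f j i) ≤ ∑ j ∈ u, ellNorm p (f j) := by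
  classical
  induction u using Finset.induction_on with
  | empty => simp [ellNorm_zero (show 0 < p by linarith)]
  | insert j u hj ih =>
    simp only [Finset.sum_insert hj]
    exact (ellNorm_add_le hp _ _).trans (by gcongr)

theorem ellNorm_mul_le (hp : 0 < p) (hpq : p < q) (hpqr : 1 / p = 1 / q + 1 / r)
    (f g : ι → ℝ≥0∞) : ellNorm p (fun i => f i * g i) ≤ ellNorm q f * ellNorm r g := by
  let : MeasurableSpace ι := ⊤
  simp only [ellNorm_eq_lintegral_count]
  exact ENNReal.lintegral_Lp_mul_le_Lq_mul_Lr hp hpq hpqr _ measurable_from_top.aemeasurable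
    measurable_from_top.aemeasurable

theorem tsum_mul_le_ellNorm_two_mul (f g : ι → ℝ≥0∞) :
    ∑' i, f i * g i ≤ ellNorm 2 f * ellNorm 2 g := by
  rw [← ellNorm_one]
  exact ellNorm_mul_le one_pos one_lt_two (by norm_num) f g

theorem ellNorm_anti_exponent (hp : 0 < p) (hpq : p ≤ q) (f : ι → ℝ≥0∞) :
    ellNorm q f ≤ ellNorm p f := by
  have hq : 0 < q := hp.trans_le hpq
  have hdiff : 0 ≤ q - p := sub_nonneg.2 hpq
  rw [← ENNReal.rpow_le_rpow_iff hq]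
  calc ellNorm q f ^ q
      = ∑' i, f i ^ p * f i ^ (q - p) := by
        rw [ellNorm_rpow hq]
        simp only [← ENNReal.rpow_add_of_nonneg _ _ hp.le hdiff, add_sub_cancel]
    _ ≤ ∑' i, f i ^ p * ellNorm p f ^ (q - p) := by
        gcongr with i
        exact le_ellNorm hp f i
    _ = ellNorm p f ^ q := by
        rw [ENNReal.tsum_mul_right, ← ellNorm_rpow hp,
          ← ENNReal.rpow_add_of_nonneg _ _ hp.le hdiff, add_sub_cancel]

theorem tsum_mul_rpow_le_rpow_tsum_mul (hp : 1 ≤ p) (w f : ι → ℝ≥0∞) :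
    (∑' i, w i * f i) ^ p ≤ (∑' i, w i) ^ (p - 1) * ∑' i, w i * f i ^ p := by
  have hp0 : 0 < p := by linarith
  have hp1 : 0 ≤ 1 - p⁻¹ := sub_nonneg.2 (inv_le_one_of_one_le₀ hp)
  have hroot : ∑' i, w i * f i ≤ (∑' i, w i) ^ (1 - p⁻¹) * (∑' i, w i * f i ^ p) ^ p⁻¹ := by
    rw [ENNReal.tsum_eq_iSup_sum]
    refine iSup_le fun u => (ENNReal.inner_le_weight_mul_Lp_of_nonneg u hp w f).trans ?_
    gcongr
    · exact ENNReal.sum_le_tsum u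
    · exact ENNReal.sum_le_tsum (f := fun i => w i * f i ^ p) u
  refine (ENNReal.rpow_le_rpow hroot hp0.le).trans_eq ?_
  rw [ENNReal.mul_rpow_of_nonneg _ _ hp0.le, ← ENNReal.rpow_mul, ← ENNReal.rpow_mul,
    inv_mul_cancel₀ hp0.ne', ENNReal.rpow_one, sub_mul, one_mul, inv_mul_cancel₀ hp0.ne']

theorem ellNorm_schur_le (hp : 1 ≤ p) (K : ι → κ → ℝ≥0∞) (F G : κ → ℝ≥0∞) {C : ℝ≥0∞}
    (hcol : ∀ k, ∑' i, K i k ≤ 1) (hrow : ∀ i, ∑' k, K i k * G k ≤ C) :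
    ellNorm p (fun i => ∑' k, K i k * (F k * G k))
      ≤ C ^ (1 - 1 / p) * (∑' k, F k ^ p * G k) ^ (1 / p) := by
  have hp0 : 0 < p := by linarith
  have hinv : 0 ≤ 1 / p := one_div_nonneg.2 hp0.le
  have hpow : ∑' i, (∑' k, K i k * (F k * G k)) ^ p ≤ C ^ (p - 1) * ∑' k, F k ^ p * G k := by
    calc ∑' i, (∑' k, K i k * (F k * G k)) ^ p
        = ∑' i, (∑' k, (K i k * G k) * F k) ^ p := by
          simp only [mul_assoc, mul_comm (F _)]
      _ ≤ ∑' i, C ^ (p - 1) * ∑' k, (K i k * G k) * F k ^ p := by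
          gcongr with i
          exact (tsum_mul_rpow_le_rpow_tsum_mul hp _ _).trans
            (mul_le_mul_left (ENNReal.rpow_le_rpow (hrow i) (sub_nonneg.2 hp)) _)
      _ = C ^ (p - 1) * ∑' k, (∑' i, K i k) * (F k ^ p * G k) := by
          rw [ENNReal.tsum_mul_left, ENNReal.tsum_comm]
          simp only [← ENNReal.tsum_mul_right, mul_assoc, mul_comm (G _)]
      _ ≤ C ^ (p - 1) * ∑' k, F k ^ p * G k := by
          exact mul_le_mul_right (ENNReal.tsum_le_tsum fun k =>
            mul_le_of_le_one_left' (hcol k)) _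
  refine (ENNReal.rpow_le_rpow hpow hinv).trans_eq ?_
  rw [ENNReal.mul_rpow_of_nonneg _ _ hinv, ← ENNReal.rpow_mul, sub_mul,
    mul_one_div_cancel hp0.ne', one_mul]

theorem tsum_pi_prod : ∀ (n : ℕ) (g : Fin n → ι → ℝ≥0∞),
    ∑' k : Fin n → ι, ∏ j, g j (k j) = ∏ j, ∑' i, g j i
  | 0, g => by simp
  | n + 1, g => by
    rw [← (Fin.insertNthEquiv (fun _ => ι) 0).tsum_eq, Fin.prod_univ_succ,
      ENNReal.tsum_prod', ← tsum_pi_prod n]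
    simp only [Fin.prod_univ_succ, Fin.insertNthEquiv_zero, Fin.consEquiv_apply, Fin.cons_zero,
      Fin.cons_succ, ENNReal.tsum_mul_left, ENNReal.tsum_mul_right]

theorem tsum_pi_mul_prod_succAbove {n : ℕ} (i : Fin (n + 1)) (f : ι → ℝ≥0∞)
    (g : Fin n → ι → ℝ≥0∞) :
    ∑' k : Fin (n + 1) → ι, f (k i) * ∏ j, g j (k (i.succAbove j))
      = (∑' l, f l) * ∏ j, ∑' l, g j l := by
  simpa only [Fin.prod_univ_succAbove _ i, Fin.insertNth_apply_same,
    Fin.insertNth_apply_succAbove] using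
    tsum_pi_prod (n + 1) (i.insertNth f g : Fin (n + 1) → ι → ℝ≥0∞)

theorem tsum_ite_eq_le_one [DecidableEq κ] (e : ι → κ) (he : e.Injective) (c : κ) :
    ∑' i, (if e i = c then (1 : ℝ≥0∞) else 0) ≤ 1 := by
  classical
  by_cases h : ∃ i, e i = c
  · obtain ⟨i, rfl⟩ := h
    rw [tsum_eq_single i fun j hj => if_neg fun hji => hj (he hji), if_pos rfl]
  · push Not at h
    simp [h]

end EllNorm

/-! ### Convolution sums -/

theorem tsum_freq {n : ℕ} {m : ℤ} (φ : (Fin n → ℤ) → ℝ≥0∞) :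
    ∑' k : Freq n m, φ k.1
      = ∑' k : Fin n → ZNonzero, (if ∑ j, (k j : ℤ) = m then 1 else 0) * φ (fun j => k j) := by
  let e : {k : Fin n → ZNonzero | ∑ j, (k j : ℤ) = m} ≃ Freq n m :=
    { toFun := fun k => ⟨fun j => k.1 j, fun j => (k.1 j).2, k.2⟩
      invFun := fun k => ⟨fun j => ⟨k.1 j, k.2.1 j⟩, k.2.2⟩
      left_inv := fun _ => rfl
      right_inv := fun _ => rfl }
  rw [← e.tsum_eq]
  refine (tsum_subtype {k : Fin n → ZNonzero | ∑ j, (k j : ℤ) = m}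
    (fun k => φ (fun j => k j))).trans (tsum_congr fun k => ?_)
  simp [Set.indicator_apply]

theorem tsum_freq_row_le {n : ℕ} (i : Fin (n + 1)) (g : Fin n → ℤ → ℝ≥0∞) (m : ℤ) :
    ∑' k : Fin (n + 1) → ZNonzero,
        (if ∑ j, (k j : ℤ) = m then 1 else 0) * ∏ j, g j (k (i.succAbove j))
      ≤ ∏ j, ∑' l : ZNonzero, g j l := by
  rw [← (Fin.insertNthEquiv (fun _ : Fin (n + 1) => ZNonzero) i).tsum_eq, ENNReal.tsum_prod',
    ENNReal.tsum_comm, ← tsum_pi_prod n (fun j (l : ZNonzero) => g j l)]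
  refine ENNReal.tsum_le_tsum fun r => ?_
  simp only [Fin.sum_univ_succAbove _ i, Fin.insertNthEquiv_apply, Fin.insertNth_apply_same,
    Fin.insertNth_apply_succAbove, ENNReal.tsum_mul_right]
  exact mul_le_of_le_one_left' (tsum_ite_eq_le_one (fun l : ZNonzero => (l : ℤ) + ∑ j, (r j : ℤ))
    (fun _ _ h => Subtype.ext (add_right_cancel h)) m)

theorem ellNorm_tsum_freq_le {p : ℝ} (hp : 1 ≤ p) {n : ℕ} (i : Fin (n + 1)) (f : ℤ → ℝ≥0∞)
    (g : Fin n → ℤ → ℝ≥0∞) :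
    ellNorm p (fun m : ZNonzero => ∑' k : Freq (n + 1) m,
        f (k.1 i) * ∏ j, g j (k.1 (i.succAbove j)))
      ≤ ellNorm p (fun l : ZNonzero => f l) * ∏ j, ∑' l : ZNonzero, g j l := by
  have hp0 : 0 < p := by linarith
  have hexp : 0 ≤ 1 - 1 / p := sub_nonneg.2 ((div_le_one hp0).2 hp)
  set P := ∏ j, ∑' l : ZNonzero, g j l
  simp only [tsum_freq (fun k : Fin (n + 1) → ℤ => f (k i) * ∏ j, g j (k (i.succAbove j)))]
  refine (ellNorm_schur_le hp
    (fun (m : ZNonzero) (k : Fin (n + 1) → ZNonzero) =>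
      if ∑ j, (k j : ℤ) = (m : ℤ) then (1 : ℝ≥0∞) else 0)
    (fun k => f (k i)) (fun k => ∏ j, g j (k (i.succAbove j))) (fun k => ?_)
    fun m => tsum_freq_row_le i g m).trans_eq ?_
  · simp only [eq_comm (a := ∑ j, (k j : ℤ))]
    exact tsum_ite_eq_le_one _ Subtype.val_injective _
  · rw [tsum_pi_mul_prod_succAbove i (fun l : ZNonzero => f l ^ p) fun j (l : ZNonzero) => g j l,
      ENNReal.mul_rpow_of_nonneg _ _ (by positivity), mul_left_comm,
      ← ENNReal.rpow_add_of_nonneg _ _ hexp (by positivity), sub_add_cancel, ENNReal.rpow_one,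
      ellNorm]

/-- The frequency sum `|m| ∑_{k₁ + ⋯ + k_n = m} ∏_j |a_j(k_j)| / |k_j|`, which dominates the
`m`-th coefficient of the `n`-linear terms of the equation. -/
def convMajorant {n : ℕ} (a : Fin n → ℤ → ℂ) (m : ℤ) : ℝ≥0∞ :=
  ‖(m : ℂ)‖ₑ * ∑' k : Freq n m, ∏ j, ‖a j (k.1 j)‖ₑ / ‖(k.1 j : ℂ)‖ₑ

theorem ellNorm_mul_convMajorant_le {p : ℝ} (hp : 1 ≤ p) {n : ℕ} {ω : ℤ → ℝ≥0∞} {B : ℝ≥0∞}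
    (hω : ∀ k : Fin (n + 1) → ℤ,
      ω (∑ j, k j) * ‖((∑ j, k j : ℤ) : ℂ)‖ₑ ≤ B * ∑ j, ω (k j) * ‖(k j : ℂ)‖ₑ)
    (a : Fin (n + 1) → ℤ → ℂ) :
    ellNorm p (fun m : ZNonzero => ω m * convMajorant a m)
      ≤ B * ∑ i, ellNorm p (fun l : ZNonzero => ω l * ‖a i l‖ₑ) *
          ∏ j, ∑' l : ZNonzero, ‖a (i.succAbove j) l‖ₑ / ‖((l : ℤ) : ℂ)‖ₑ := by
  have hp0 : 0 < p := by linarith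
  have hpointwise : ∀ m : ZNonzero, ω m * convMajorant a m
      ≤ B * ∑ i, ∑' k : Freq (n + 1) m, (ω (k.1 i) * ‖a i (k.1 i)‖ₑ) *
          ∏ j, ‖a (i.succAbove j) (k.1 (i.succAbove j))‖ₑ / ‖(k.1 (i.succAbove j) : ℂ)‖ₑ := by
    intro m
    rw [convMajorant, ← mul_assoc, ← (Summable.tsum_finsetSum fun i _ => ENNReal.summable),
      ← ENNReal.tsum_mul_left, ← ENNReal.tsum_mul_left]
    refine ENNReal.tsum_le_tsum fun k => ?_
    have hk := hω k.1
    rw [k.2.2] at hk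
    refine (mul_le_mul_left hk _).trans_eq ?_
    rw [mul_assoc, Finset.sum_mul]
    congr 1
    refine Finset.sum_congr rfl fun i _ => ?_
    have hki : ‖(k.1 i : ℂ)‖ₑ ≠ 0 := by simpa using k.2.1 i
    rw [Fin.prod_univ_succAbove _ i, ← mul_assoc, mul_assoc (ω _),
      ENNReal.mul_div_cancel hki enorm_ne_top]
  refine (ellNorm_mono hp0.le hpointwise).trans ?_
  rw [ellNorm_const_mul hp0]
  gcongr
  refine (ellNorm_sum_le hp _ _).trans ?_
  gcongr with i
  exact ellNorm_tsum_freq_le hp i (fun l => ω l * ‖a i l‖ₑ)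
    (fun j l => ‖a (i.succAbove j) l‖ₑ / ‖(l : ℂ)‖ₑ)

/-! ### Weights and embeddings -/

/-- The weight `|k|^s min(|k|, N)^σ`. It grows only like `|k|^s` when `N < ∞`, and increases to
`|k|^{s + σ}` as `N → ∞`. -/
def truncWeight (s σ : ℝ) (N : ℝ≥0∞) (k : ℤ) : ℝ≥0∞ := ‖(k : ℂ)‖ₑ ^ s * min ‖(k : ℂ)‖ₑ N ^ σ

theorem truncWeight_zero_exponent (s : ℝ) (N : ℝ≥0∞) (k : ℤ) :
    truncWeight s 0 N k = ‖(k : ℂ)‖ₑ ^ s := by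
  simp [truncWeight]

/-- The largest `|k_j|` is at least `|∑ k_j| / n`. -/
theorem truncWeight_sum_mul_enorm_le {s σ : ℝ} (hs : 0 ≤ s) (hσ : 0 ≤ σ) (N : ℝ≥0∞) {n : ℕ}
    (k : Fin (n + 1) → ℤ) :
    truncWeight s σ N (∑ j, k j) * ‖((∑ j, k j : ℤ) : ℂ)‖ₑ
      ≤ ((n + 1 : ℕ) : ℝ≥0∞) ^ (1 + s + σ) * ∑ j, truncWeight s σ N (k j) * ‖(k j : ℂ)‖ₑ := by
  obtain ⟨i, -, hi⟩ := Finset.exists_max_image Finset.univ (fun j => ‖(k j : ℂ)‖ₑ)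
    Finset.univ_nonempty
  set M := ‖(k i : ℂ)‖ₑ
  set c : ℝ≥0∞ := ((n + 1 : ℕ) : ℝ≥0∞)
  have hsum : ‖((∑ j, k j : ℤ) : ℂ)‖ₑ ≤ c * M := by
    push_cast
    refine (enorm_sum_le _ _).trans ((Finset.sum_le_card_nsmul _ _ M hi).trans_eq ?_)
    simp [c]
  have hmin : min ‖((∑ j, k j : ℤ) : ℂ)‖ₑ N ≤ c * min M N := by
    rw [mul_min]
    exact min_le_min hsum (le_mul_of_one_le_left' (by simp [c]))
  calc truncWeight s σ N (∑ j, k j) * ‖((∑ j, k j : ℤ) : ℂ)‖ₑ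
      ≤ ((c * M) ^ s * (c * min M N) ^ σ) * (c * M) := by
        unfold truncWeight
        gcongr
    _ = c ^ (1 + s + σ) * (truncWeight s σ N (k i) * M) := by
        rw [ENNReal.mul_rpow_of_nonneg _ _ hs, ENNReal.mul_rpow_of_nonneg _ _ hσ,
          ENNReal.rpow_add_of_nonneg _ _ (by positivity) hσ,
          ENNReal.rpow_add_of_nonneg _ _ zero_le_one hs, ENNReal.rpow_one, truncWeight]
        ring
    _ ≤ c ^ (1 + s + σ) * ∑ j, truncWeight s σ N (k j) * ‖(k j : ℂ)‖ₑ := by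
        gcongr
        exact Finset.single_le_sum (f := fun j => truncWeight s σ N (k j) * ‖(k j : ℂ)‖ₑ)
          (fun j _ => zero_le) (Finset.mem_univ i)

theorem one_le_enorm_znonzero (k : ZNonzero) : 1 ≤ ‖((k : ℤ) : ℂ)‖ₑ := by
  rw [← ofReal_norm, ENNReal.one_le_ofReal, Complex.norm_intCast]
  exact_mod_cast Int.one_le_abs k.2

theorem enorm_znonzero_ne_zero (k : ZNonzero) : ‖((k : ℤ) : ℂ)‖ₑ ≠ 0 :=
  (one_pos.trans_le (one_le_enorm_znonzero k)).ne'

theorem ofReal_abs_rpow_znonzero (k : ZNonzero) (r : ℝ) :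
    ENNReal.ofReal (|((k : ℤ) : ℝ)| ^ r) = ‖((k : ℤ) : ℂ)‖ₑ ^ r := by
  rw [← ENNReal.ofReal_rpow_of_pos (by simpa using k.2), ← ofReal_norm, Complex.norm_intCast]

theorem flNorm_eq_ellNorm (s p : ℝ) (a : ℤ → ℂ) :
    flNorm s p a = ellNorm p (fun k : ZNonzero => ‖((k : ℤ) : ℂ)‖ₑ ^ s * ‖a k‖ₑ) := by
  simp only [flNorm, ellNorm, ofReal_abs_rpow_znonzero]

theorem ellNorm_rpow_neg_lt_top {r q : ℝ} (hq : 0 < q) (hrq : 1 < r * q) :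
    ellNorm q (fun k : ZNonzero => ‖((k : ℤ) : ℂ)‖ₑ ^ (-r)) < ∞ := by
  have hsummable : Summable fun k : ZNonzero => |((k : ℤ) : ℝ)| ^ (-(r * q)) :=
    (Real.summable_abs_int_rpow hrq).comp_injective Subtype.val_injective
  refine ENNReal.rpow_lt_top_of_nonneg (by positivity) ?_
  simp only [← ENNReal.rpow_mul, neg_mul]
  simp only [← ofReal_abs_rpow_znonzero]
  exact hsummable.tsum_ofReal_ne_top

/-- The space `FL^{s,p}`, with `s ≥ 0` and `p ≥ 1`, embeds into `L²` with norm at most `C`. -/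
structure EmbedsInL2 (s p : ℝ) (C : ℝ≥0) : Prop where
  one_le_exponent : 1 ≤ p
  regularity_nonneg : 0 ≤ s
  ellNorm_two_le : ∀ a : ℤ → ℂ, ellNorm 2 (fun k : ZNonzero => ‖a k‖ₑ) ≤ C * flNorm s p a

theorem EmbedsInL2.exponent_pos {s p : ℝ} {C : ℝ≥0} (h : EmbedsInL2 s p C) : 0 < p :=
  one_pos.trans_le h.one_le_exponent

theorem embedsInL2_of_le_two {s p : ℝ} (hs : 0 ≤ s) (hp : 1 ≤ p) (hp2 : p ≤ 2) :
    EmbedsInL2 s p 1 where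
  one_le_exponent := hp
  regularity_nonneg := hs
  ellNorm_two_le a := by
    have hp0 : 0 < p := one_pos.trans_le hp
    rw [flNorm_eq_ellNorm, ENNReal.coe_one, one_mul]
    refine (ellNorm_anti_exponent hp0 hp2 _).trans (ellNorm_mono hp0.le fun k => ?_)
    exact le_mul_of_one_le_left' (by
      simpa using ENNReal.rpow_le_rpow (one_le_enorm_znonzero k) hs)

theorem exists_embedsInL2_of_two_lt {s p : ℝ} (hs : 1 / 2 - 1 / p < s) (hp : 2 < p) :
    ∃ C, EmbedsInL2 s p C := by
  have hgap : 0 < 1 / 2 - 1 / p := sub_pos.2 (one_div_lt_one_div_of_lt two_pos hp)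
  set q := (1 / 2 - 1 / p)⁻¹ with hq
  have hq0 : 0 < q := inv_pos.2 hgap
  have hweight : ellNorm q (fun k : ZNonzero => ‖((k : ℤ) : ℂ)‖ₑ ^ (-s)) < ∞ :=
    ellNorm_rpow_neg_lt_top hq0 (by rwa [hq, ← div_eq_mul_inv, one_lt_div hgap])
  lift ellNorm q (fun k : ZNonzero => ‖((k : ℤ) : ℂ)‖ₑ ^ (-s)) to ℝ≥0 using hweight.ne
    with C hC
  refine ⟨C, by linarith, by linarith, fun a => ?_⟩
  calc ellNorm 2 (fun k : ZNonzero => ‖a k‖ₑ)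
      = ellNorm 2 (fun k : ZNonzero =>
          (‖((k : ℤ) : ℂ)‖ₑ ^ s * ‖a k‖ₑ) * ‖((k : ℤ) : ℂ)‖ₑ ^ (-s)) := by
        congr 1 with k
        rw [mul_right_comm, ← ENNReal.rpow_add _ _ (enorm_znonzero_ne_zero k) enorm_ne_top]
        simp
    _ ≤ flNorm s p a * ellNorm q (fun k : ZNonzero => ‖((k : ℤ) : ℂ)‖ₑ ^ (-s)) := by
        rw [flNorm_eq_ellNorm]
        exact ellNorm_mul_le two_pos hp (by simp [hq]) _ _
    _ = C * flNorm s p a := by rw [hC, mul_comm]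

theorem exists_embedsInL2 {s p : ℝ} (hp : 1 ≤ p)
    (hsp : (1 / 2 - 1 / p < s ∧ 2 < p) ∨ (0 ≤ s ∧ p ≤ 2)) : ∃ C, EmbedsInL2 s p C := by
  rcases hsp with ⟨hs, hp2⟩ | ⟨hs, hp2⟩
  exacts [exists_embedsInL2_of_two_lt hs hp2, ⟨1, embedsInL2_of_le_two hs hp hp2⟩]

/-- The constant in `∑ |a_k| / |k| ≤ invWeightNorm * ‖a‖_{ℓ²}`. -/
def invWeightNorm : ℝ≥0 :=
  (ellNorm 2 (fun k : ZNonzero => ‖((k : ℤ) : ℂ)‖ₑ ^ (-1 : ℝ))).toNNReal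

theorem EmbedsInL2.tsum_enorm_div_le {s p : ℝ} {C : ℝ≥0} (h : EmbedsInL2 s p C) (a : ℤ → ℂ) :
    ∑' k : ZNonzero, ‖a k‖ₑ / ‖((k : ℤ) : ℂ)‖ₑ ≤ (C * invWeightNorm : ℝ≥0) * flNorm s p a := by
  have hfinite := ellNorm_rpow_neg_lt_top (r := 1) (q := 2) two_pos (by norm_num)
  calc ∑' k : ZNonzero, ‖a k‖ₑ / ‖((k : ℤ) : ℂ)‖ₑ
      = ∑' k : ZNonzero, ‖a k‖ₑ * ‖((k : ℤ) : ℂ)‖ₑ ^ (-1 : ℝ) := by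
        simp only [div_eq_mul_inv, ENNReal.rpow_neg_one]
    _ ≤ ellNorm 2 (fun k : ZNonzero => ‖a k‖ₑ) *
          ellNorm 2 (fun k : ZNonzero => ‖((k : ℤ) : ℂ)‖ₑ ^ (-1 : ℝ)) :=
        tsum_mul_le_ellNorm_two_mul _ _
    _ ≤ (C * flNorm s p a) * invWeightNorm := by
        rw [invWeightNorm, ENNReal.coe_toNNReal hfinite.ne]
        gcongr
        exact h.ellNorm_two_le a
    _ = (C * invWeightNorm : ℝ≥0) * flNorm s p a := by
        rw [ENNReal.coe_mul, mul_right_comm]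

/-! ### Integral equations with small Lipschitz nonlinearities -/

section IntegralEquation

variable {E E' : Type*} [NormedAddCommGroup E] [NormedAddCommGroup E']

/-- A time-dependent nonlinearity vanishing at `0`, jointly continuous and `1/8`-Lipschitz on the
closed ball of radius `ρ`. The constant is such that the integral equation below is a contraction
on time intervals of length at most `1`. -/
structure IsSmallLipschitz (ρ : ℝ) (F : ℝ → E → E) : Prop where
  zero : ∀ t, F t 0 = 0
  lipschitz : ∀ t x y, ‖x‖ ≤ ρ → ‖y‖ ≤ ρ → ‖F t x - F t y‖ ≤ 1 / 8 * ‖x - y‖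
  continuousOn : ContinuousOn (Function.uncurry F) (univ ×ˢ Metric.closedBall (0 : E) ρ)

namespace IsSmallLipschitz

variable {ρ : ℝ} {F : ℝ → E → E}

theorem norm_le (hF : IsSmallLipschitz ρ F) (t : ℝ) {x : E} (hx : ‖x‖ ≤ ρ) :
    ‖F t x‖ ≤ 1 / 8 * ‖x‖ := by
  simpa [hF.zero] using hF.lipschitz t x 0 hx (by simpa using (norm_nonneg x).trans hx)

theorem comp_continuousOn (hF : IsSmallLipschitz ρ F) {x : ℝ → E} {u : Set ℝ}
    (hx : ContinuousOn x u) (hxρ : ∀ t ∈ u, ‖x t‖ ≤ ρ) :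
    ContinuousOn (fun t => F t (x t)) u :=
  hF.continuousOn.comp (continuousOn_id.prodMk hx) fun t ht =>
    ⟨mem_univ _, by simpa using hxρ t ht⟩

theorem intervalIntegrable (hF : IsSmallLipschitz ρ F) {x : ℝ → E} {t : ℝ} (ht : 0 ≤ t)
    (hx : ContinuousOn x (Icc 0 t)) (hxρ : ∀ t' ∈ Icc 0 t, ‖x t'‖ ≤ ρ) :
    IntervalIntegrable (fun t' => F t' (x t')) volume 0 t :=
  ContinuousOn.intervalIntegrable (by rw [uIcc_of_le ht]; exact hF.comp_continuousOn hx hxρ)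

end IsSmallLipschitz

variable [NormedSpace ℝ E] [NormedSpace ℝ E']

/-- The right-hand side `φ + F(t, x(t)) - F(0, φ) + ∫₀ᵗ K(t', x(t')) dt'` of the integral
equation. -/
def duhamel (F K : ℝ → E → E) (φ : E) (x : ℝ → E) (t : ℝ) : E :=
  φ + F t (x t) - F 0 φ + ∫ t' in (0 : ℝ)..t, K t' (x t')

theorem norm_intervalIntegral_le_of_le_one {g : ℝ → E} {t C : ℝ} (ht : t ∈ Icc (0 : ℝ) 1)
    (hC : 0 ≤ C) (hg : ∀ t' ∈ Icc 0 t, ‖g t'‖ ≤ C) : ‖∫ t' in (0 : ℝ)..t, g t'‖ ≤ C := by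
  have hbound := intervalIntegral.norm_integral_le_of_norm_le_const (a := 0) (b := t) (f := g)
    fun t' ht' => hg t' (by rw [uIoc_of_le ht.1] at ht'; exact Ioc_subset_Icc_self ht')
  refine hbound.trans ?_
  rw [sub_zero, abs_of_nonneg ht.1]
  exact mul_le_of_le_one_right hC ht.2

variable {F K : ℝ → E → E} {ρ : ℝ} {φ : E} {x y : ℝ → E} {t : ℝ}

theorem continuous_duhamel (hF : IsSmallLipschitz ρ F) (hK : IsSmallLipschitz ρ K)
    (hx : Continuous x) (hxρ : ∀ t, ‖x t‖ ≤ ρ) : Continuous (duhamel F K φ x) := by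
  have hcomp : ∀ {G : ℝ → E → E}, IsSmallLipschitz ρ G → Continuous fun t => G t (x t) :=
    fun hG => by
      rw [← continuousOn_univ]
      exact hG.comp_continuousOn hx.continuousOn fun t _ => hxρ t
  exact ((continuous_const.add (hcomp hF)).sub continuous_const).add
    (intervalIntegral.continuous_primitive (fun a b => (hcomp hK).intervalIntegrable a b) 0)

theorem norm_map_duhamel_le [CompleteSpace E] [CompleteSpace E'] (L : E →L[ℝ] E')
    (hK : IsSmallLipschitz ρ K)
    (hLF : ∀ t x, ‖x‖ ≤ ρ → ‖L (F t x)‖ ≤ 1 / 8 * ‖L x‖)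
    (hLK : ∀ t x, ‖x‖ ≤ ρ → ‖L (K t x)‖ ≤ 1 / 8 * ‖L x‖)
    (ht : t ∈ Icc (0 : ℝ) 1) (hφ : ‖φ‖ ≤ ρ) (hx : ContinuousOn x (Icc 0 t))
    (hxρ : ∀ t' ∈ Icc 0 t, ‖x t'‖ ≤ ρ) {D : ℝ} (hD : ∀ t' ∈ Icc 0 t, ‖L (x t')‖ ≤ D) :
    ‖L (duhamel F K φ x t)‖ ≤ 9 / 8 * ‖L φ‖ + D / 4 := by
  have htt : t ∈ Icc 0 t := right_mem_Icc.2 ht.1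
  have hD0 : 0 ≤ D := (norm_nonneg _).trans (hD t htt)
  have hsum : L (duhamel F K φ x t)
      = L φ + L (F t (x t)) - L (F 0 φ) + ∫ t' in (0 : ℝ)..t, L (K t' (x t')) := by
    rw [L.intervalIntegral_comp_comm (hK.intervalIntegrable ht.1 hx hxρ), ← map_add, ← map_sub,
      ← map_add, duhamel]
  have hint : ‖∫ t' in (0 : ℝ)..t, L (K t' (x t'))‖ ≤ 1 / 8 * D :=
    norm_intervalIntegral_le_of_le_one ht (by positivity) fun t' ht' =>
      (hLK t' _ (hxρ t' ht')).trans (by gcongr; exact hD t' ht')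
  calc ‖L (duhamel F K φ x t)‖
      ≤ ‖L φ‖ + ‖L (F t (x t))‖ + ‖L (F 0 φ)‖ + ‖∫ t' in (0 : ℝ)..t, L (K t' (x t'))‖ := by
        rw [hsum]
        refine (norm_add_le _ _).trans ?_
        gcongr
        exact (norm_sub_le _ _).trans (by gcongr; exact norm_add_le _ _)
    _ ≤ ‖L φ‖ + 1 / 8 * D + 1 / 8 * ‖L φ‖ + 1 / 8 * D := by
        gcongr
        exacts [(hLF t _ (hxρ t htt)).trans (by gcongr; exact hD t htt), hLF 0 φ hφ]
    _ = 9 / 8 * ‖L φ‖ + D / 4 := by ring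

theorem norm_duhamel_le [CompleteSpace E] (hF : IsSmallLipschitz ρ F) (hK : IsSmallLipschitz ρ K)
    (ht : t ∈ Icc (0 : ℝ) 1) (hφ : ‖φ‖ ≤ ρ / 2) (hx : ContinuousOn x (Icc 0 t))
    (hxρ : ∀ t' ∈ Icc 0 t, ‖x t'‖ ≤ ρ) : ‖duhamel F K φ x t‖ ≤ ρ := by
  have hle := norm_map_duhamel_le (ContinuousLinearMap.id ℝ E) hK (fun t _ => hF.norm_le t)
    (fun t _ => hK.norm_le t) ht (by linarith [norm_nonneg φ]) hx hxρ hxρ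
  simp only [ContinuousLinearMap.id_apply] at hle
  linarith [norm_nonneg φ]

theorem norm_duhamel_sub_duhamel_le (hF : IsSmallLipschitz ρ F) (hK : IsSmallLipschitz ρ K)
    (ht : t ∈ Icc (0 : ℝ) 1) (hx : ContinuousOn x (Icc 0 t)) (hy : ContinuousOn y (Icc 0 t))
    (hxρ : ∀ t' ∈ Icc 0 t, ‖x t'‖ ≤ ρ) (hyρ : ∀ t' ∈ Icc 0 t, ‖y t'‖ ≤ ρ) {D : ℝ}
    (hD : ∀ t' ∈ Icc 0 t, ‖x t' - y t'‖ ≤ D) :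
    ‖duhamel F K φ x t - duhamel F K φ y t‖ ≤ D / 4 := by
  have htt : t ∈ Icc 0 t := right_mem_Icc.2 ht.1
  have hD0 : 0 ≤ D := (norm_nonneg _).trans (hD t htt)
  have hlip : ∀ {G : ℝ → E → E}, IsSmallLipschitz ρ G → ∀ t' ∈ Icc 0 t,
      ‖G t' (x t') - G t' (y t')‖ ≤ 1 / 8 * D := fun hG t' ht' =>
    (hG.lipschitz t' _ _ (hxρ t' ht') (hyρ t' ht')).trans (by gcongr; exact hD t' ht')
  have hdiff : duhamel F K φ x t - duhamel F K φ y t = (F t (x t) - F t (y t))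
      + ∫ t' in (0 : ℝ)..t, (K t' (x t') - K t' (y t')) := by
    rw [intervalIntegral.integral_sub (hK.intervalIntegrable ht.1 hx hxρ)
      (hK.intervalIntegrable ht.1 hy hyρ), duhamel, duhamel]
    abel
  calc ‖duhamel F K φ x t - duhamel F K φ y t‖
      ≤ ‖F t (x t) - F t (y t)‖ + ‖∫ t' in (0 : ℝ)..t, (K t' (x t') - K t' (y t'))‖ := by
        rw [hdiff]
        exact norm_add_le _ _
    _ ≤ 1 / 8 * D + 1 / 8 * D :=
        add_le_add (hlip hF t htt)
          (norm_intervalIntegral_le_of_le_one ht (by positivity) (hlip hK))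
    _ = D / 4 := by ring

theorem eq_of_eq_duhamel_zero (hF : IsSmallLipschitz ρ F) (hφ : ‖φ‖ ≤ ρ) (hxρ : ‖x 0‖ ≤ ρ)
    (heq : x 0 = duhamel F K φ x 0) : x 0 = φ := by
  rw [duhamel, intervalIntegral.integral_same, add_zero] at heq
  have hsub : x 0 - φ = F 0 (x 0) - F 0 φ := by
    nth_rewrite 1 [heq]
    abel
  have hlip := hF.lipschitz 0 _ _ hxρ hφ
  rw [← hsub] at hlip
  exact sub_eq_zero.1 (norm_le_zero_iff.1 (by linarith [norm_nonneg (x 0 - φ)]))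

theorem le_of_le_add_quarter_sup {d : ℝ → ℝ} {τ A : ℝ} (hd : ContinuousOn d (Icc 0 τ))
    (h : ∀ t ∈ Icc 0 τ, ∀ D, (∀ t' ∈ Icc 0 τ, d t' ≤ D) → d t ≤ A + D / 4) :
    ∀ t ∈ Icc 0 τ, d t ≤ 4 / 3 * A := by
  intro t ht
  obtain ⟨t₀, ht₀, hmax⟩ := isCompact_Icc.exists_isMaxOn ⟨t, ht⟩ hd
  have hsup : d t₀ ≤ A + d t₀ / 4 := h t₀ ht₀ (d t₀) fun t' ht' => hmax ht'
  have hle : d t ≤ d t₀ := hmax ht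
  linarith

theorem norm_map_le_of_eqOn_duhamel [CompleteSpace E] [CompleteSpace E'] (L : E →L[ℝ] E')
    (hK : IsSmallLipschitz ρ K)
    (hLF : ∀ t x, ‖x‖ ≤ ρ → ‖L (F t x)‖ ≤ 1 / 8 * ‖L x‖)
    (hLK : ∀ t x, ‖x‖ ≤ ρ → ‖L (K t x)‖ ≤ 1 / 8 * ‖L x‖)
    {τ : ℝ} (hτ : τ ≤ 1) (hφ : ‖φ‖ ≤ ρ) (hx : ContinuousOn x (Icc 0 τ))
    (hxρ : ∀ t ∈ Icc 0 τ, ‖x t‖ ≤ ρ) (heq : EqOn x (duhamel F K φ x) (Icc 0 τ)) :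
    ∀ t ∈ Icc 0 τ, ‖L (x t)‖ ≤ 3 / 2 * ‖L φ‖ := by
  have hsup := le_of_le_add_quarter_sup (d := fun t => ‖L (x t)‖) (A := 9 / 8 * ‖L φ‖)
    (L.continuous.comp_continuousOn hx).norm fun t ht D hD => by
      have hsub : Icc 0 t ⊆ Icc 0 τ := Icc_subset_Icc_right ht.2
      rw [heq ht]
      exact norm_map_duhamel_le L hK hLF hLK ⟨ht.1, ht.2.trans hτ⟩ hφ (hx.mono hsub)
        (fun t' ht' => hxρ t' (hsub ht')) fun t' ht' => hD t' (hsub ht')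
  intro t ht
  linarith [hsup t ht]

/-- A continuity argument: the a priori bound `3/2 * ‖φ‖ < ρ` prevents the solution from leaving
the ball of radius `ρ`, so the equation is needed only as long as it has not left. -/
theorem norm_le_of_eq_duhamel [CompleteSpace E] (hρ : 0 < ρ)
    (hF : IsSmallLipschitz ρ F) (hK : IsSmallLipschitz ρ K) (hφ : ‖φ‖ ≤ ρ / 2)
    (hx : ContinuousOn x (Icc 0 1)) (hx0 : x 0 = φ)
    (heq : ∀ t ∈ Icc (0 : ℝ) 1, (∀ t' ∈ Icc 0 t, ‖x t'‖ ≤ ρ) → x t = duhamel F K φ x t) :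
    ∀ t ∈ Icc (0 : ℝ) 1, ‖x t‖ ≤ 3 / 2 * ‖φ‖ := by
  have hapriori : ∀ τ ∈ Icc (0 : ℝ) 1, (∀ t ∈ Icc 0 τ, ‖x t‖ ≤ ρ) →
      ∀ t ∈ Icc 0 τ, ‖x t‖ ≤ 3 / 2 * ‖φ‖ := fun τ hτ hball =>
    norm_map_le_of_eqOn_duhamel (ContinuousLinearMap.id ℝ E) hK
      (fun t _ => hF.norm_le t) (fun t _ => hK.norm_le t) hτ.2 (by linarith)
      (hx.mono (Icc_subset_Icc_right hτ.2)) hball fun t ht =>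
        heq t ⟨ht.1, ht.2.trans hτ.2⟩ fun t' ht' => hball t' ⟨ht'.1, ht'.2.trans ht.2⟩
  have hstay : Icc (0 : ℝ) 1 ⊆ {t | ‖x t‖ ≤ ρ} := by
    refine IsClosed.Icc_subset_of_forall_mem_nhdsGT_of_Icc_subset ?_ ?_ fun t ht hball => ?_
    · rw [inter_comm]
      exact hx.norm.preimage_isClosed_of_isClosed isClosed_Icc isClosed_Iic
    · simp only [mem_ofPred_eq, hx0]
      linarith
    · have hlt : ‖x t‖ < ρ := by
        linarith [hapriori t ⟨ht.1, ht.2.le⟩ hball t (right_mem_Icc.2 ht.1)]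
      have hev : ∀ᶠ t' in 𝓝[Icc 0 1] t, ‖x t'‖ < ρ :=
        (hx.norm t ⟨ht.1, ht.2.le⟩).eventually_lt_const hlt
      have hle : 𝓝[>] t ≤ 𝓝[Icc 0 1] t := by
        rw [← nhdsWithin_Ioc_eq_nhdsGT ht.2]
        exact nhdsWithin_mono _ fun u hu => ⟨ht.1.trans hu.1.le, hu.2⟩
      exact (hev.filter_mono hle).mono fun t' => le_of_lt
  exact hapriori 1 (by simp) hstay

theorem eqOn_of_eqOn_duhamel (hF : IsSmallLipschitz ρ F) (hK : IsSmallLipschitz ρ K)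
    (hx : ContinuousOn x (Icc 0 1)) (hy : ContinuousOn y (Icc 0 1))
    (hxρ : ∀ t ∈ Icc (0 : ℝ) 1, ‖x t‖ ≤ ρ) (hyρ : ∀ t ∈ Icc (0 : ℝ) 1, ‖y t‖ ≤ ρ)
    (hxeq : EqOn x (duhamel F K φ x) (Icc 0 1)) (hyeq : EqOn y (duhamel F K φ y) (Icc 0 1)) :
    EqOn x y (Icc 0 1) := by
  have hsup := le_of_le_add_quarter_sup (d := fun t => ‖x t - y t‖) (A := 0)
    (hx.sub hy).norm fun t ht D hD => by
      have hsub : Icc 0 t ⊆ Icc 0 1 := Icc_subset_Icc_right ht.2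
      rw [zero_add, hxeq ht, hyeq ht]
      exact norm_duhamel_sub_duhamel_le hF hK ht (hx.mono hsub) (hy.mono hsub)
        (fun t' ht' => hxρ t' (hsub ht')) (fun t' ht' => hyρ t' (hsub ht'))
        fun t' ht' => hD t' (hsub ht')
  intro t ht
  exact sub_eq_zero.1 (norm_le_zero_iff.1 (by simpa using hsup t ht))

theorem exists_eqOn_duhamel [CompleteSpace E] (hρ : 0 < ρ)
    (hF : IsSmallLipschitz ρ F) (hK : IsSmallLipschitz ρ K) (hφ : ‖φ‖ ≤ ρ / 2) :
    ∃ x : ℝ → E, Continuous x ∧ (∀ t, ‖x t‖ ≤ ρ) ∧ EqOn x (duhamel F K φ x) (Icc 0 1) := by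
  let Y := Metric.closedBall (0 : C(Icc (0 : ℝ) 1, E)) ρ
  let path : Y → ℝ → E := fun v => IccExtend zero_le_one v.1
  have hpath : ∀ v, Continuous (path v) := fun v => v.1.continuous.Icc_extend'
  have hpathρ : ∀ v t, ‖path v t‖ ≤ ρ := fun v t =>
    (v.1.norm_coe_le_norm _).trans (mem_closedBall_zero_iff.1 v.2)
  let f : Y → Y := fun v =>
    ⟨⟨fun t => duhamel F K φ (path v) t,
      (continuous_duhamel hF hK (hpath v) (hpathρ v)).comp continuous_subtype_val⟩, by
        rw [mem_closedBall_zero_iff, ContinuousMap.norm_le _ hρ.le]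
        exact fun t => norm_duhamel_le hF hK t.2 hφ (hpath v).continuousOn fun t' _ => hpathρ v t'⟩
  have hf : ContractingWith (1 / 4) f := by
    refine ⟨by norm_num, LipschitzWith.of_dist_le_mul fun v w => ?_⟩
    rw [Subtype.dist_eq, ContinuousMap.dist_le (by positivity)]
    intro t
    have hle := norm_duhamel_sub_duhamel_le (φ := φ) hF hK t.2 (hpath v).continuousOn
      (hpath w).continuousOn (fun t' _ => hpathρ v t') (fun t' _ => hpathρ w t') fun t' _ =>
        (dist_eq_norm (path v t') (path w t')).ge.trans (ContinuousMap.dist_apply_le_dist _)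
    rw [dist_eq_norm]
    refine hle.trans_eq ?_
    rw [Subtype.dist_eq]
    push_cast
    ring
  have : Nonempty Y := ⟨⟨0, Metric.mem_closedBall_self hρ.le⟩⟩
  have : CompleteSpace Y := Metric.isClosed_closedBall.completeSpace_coe
  let v := hf.fixedPoint f
  refine ⟨path v, hpath v, hpathρ v, fun t ht => ?_⟩
  calc path v t = v.1 ⟨t, ht⟩ := IccExtend_of_mem _ _ ht
    _ = (f v).1 ⟨t, ht⟩ := by rw [hf.fixedPoint_isFixedPt.eq]
    _ = duhamel F K φ (path v) t := rfl

end IntegralEquation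

/-! ### Spaces of Fourier coefficients -/

instance fact_one_le_ofReal {p : ℝ} [Fact (1 ≤ p)] : Fact (1 ≤ ENNReal.ofReal p) :=
  ⟨ENNReal.one_le_ofReal.2 Fact.out⟩

theorem exponent_pos {p : ℝ} [hp : Fact (1 ≤ p)] : 0 < p := one_pos.trans_le hp.out

section LpNorm

variable {ι : Type*} {E : ι → Type*} [∀ i, NormedAddCommGroup (E i)] {p : ℝ}

theorem memℓp_iff_ellNorm_lt_top (hp : 0 < p) {x : ∀ i, E i} :
    Memℓp x (ENNReal.ofReal p) ↔ ellNorm p (fun i => ‖x i‖ₑ) < ∞ := by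
  rw [memℓp_gen_iff (by rwa [ENNReal.toReal_ofReal hp.le]), ENNReal.toReal_ofReal hp.le, ellNorm,
    ENNReal.rpow_lt_top_iff_of_pos (by positivity), lt_top_iff_ne_top]
  simp only [← ofReal_norm, ENNReal.ofReal_rpow_of_nonneg (norm_nonneg _) hp.le]
  refine ⟨Summable.tsum_ofReal_ne_top, fun h => (ENNReal.summable_toReal h).congr fun i => ?_⟩
  rw [ENNReal.toReal_ofReal (by positivity)]

theorem enorm_eq_ellNorm [Fact (1 ≤ p)] (x : lp E (ENNReal.ofReal p)) :
    ‖x‖ₑ = ellNorm p (fun i => ‖x i‖ₑ) := by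
  have hp : 0 < p := exponent_pos
  have hp' : 0 < (ENNReal.ofReal p).toReal := by rwa [ENNReal.toReal_ofReal hp.le]
  have hsummable := (lp.memℓp x).summable hp'
  rw [← ofReal_norm, lp.norm_eq_tsum_rpow hp', ellNorm]
  rw [ENNReal.toReal_ofReal hp.le] at hsummable ⊢
  simp only [← ofReal_norm, ENNReal.ofReal_rpow_of_nonneg (norm_nonneg _) hp.le]
  rw [← ENNReal.ofReal_tsum_of_nonneg (fun i => by positivity) hsummable,
    ENNReal.ofReal_rpow_of_nonneg (tsum_nonneg fun i => by positivity) (by positivity)]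

end LpNorm

/-- The space `ℓ^p(ℤ₀)`, which parametrizes `FL₀^{s,p}` through `x_k = |k|^s f_k`. -/
abbrev SeqSpace (p : ℝ) : Type := lp (fun _ : ZNonzero => ℂ) (ENNReal.ofReal p)

section SeqSpace

variable {p : ℝ}

/-- The Fourier coefficients `|k|^{-s} x_k`, extended by `0` to the zero frequency, of the element
of `FL₀^{s,p}` parametrized by `x ∈ ℓ^p(ℤ₀)`. -/
def toCoeff (s : ℝ) : SeqSpace p →ₗ[ℂ] (ℤ → ℂ) where
  toFun x k := if h : k ≠ 0 then ((|(k : ℝ)| ^ (-s) : ℝ) : ℂ) * x ⟨k, h⟩ else 0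
  map_add' x y := by
    ext k
    by_cases h : k = 0 <;> simp [h, mul_add]
  map_smul' c x := by
    ext k
    by_cases h : k = 0 <;> simp [h, mul_left_comm]

theorem toCoeff_zero_freq (s : ℝ) (x : SeqSpace p) : toCoeff s x 0 = 0 := by simp [toCoeff]

theorem toCoeff_apply (s : ℝ) (x : SeqSpace p) (k : ZNonzero) :
    toCoeff s x k = ((|((k : ℤ) : ℝ)| ^ (-s) : ℝ) : ℂ) * x k := by
  simp [toCoeff, k.2]

theorem ofReal_abs_rpow_mul_cancel (s : ℝ) (k : ZNonzero) (z : ℂ) :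
    ((|((k : ℤ) : ℝ)| ^ s : ℝ) : ℂ) * (((|((k : ℤ) : ℝ)| ^ (-s) : ℝ) : ℂ) * z) = z := by
  rw [← mul_assoc, ← Complex.ofReal_mul, ← Real.rpow_add (by simpa using k.2)]
  simp

theorem apply_eq_mul_toCoeff (s : ℝ) (x : SeqSpace p) (k : ZNonzero) :
    x k = ((|((k : ℤ) : ℝ)| ^ s : ℝ) : ℂ) * toCoeff s x k := by
  rw [toCoeff_apply, ofReal_abs_rpow_mul_cancel]

theorem enorm_ofReal_abs_rpow (s : ℝ) (k : ZNonzero) :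
    ‖((|((k : ℤ) : ℝ)| ^ s : ℝ) : ℂ)‖ₑ = ‖((k : ℤ) : ℂ)‖ₑ ^ s := by
  rw [← ofReal_norm, Complex.norm_real, Real.norm_of_nonneg (by positivity),
    ofReal_abs_rpow_znonzero]

theorem toCoeff_injective (s : ℝ) : Function.Injective (toCoeff (p := p) s) := fun x y h =>
  lp.ext (funext fun k => by rw [apply_eq_mul_toCoeff s x, apply_eq_mul_toCoeff s y, h])

theorem flNorm_toCoeff [Fact (1 ≤ p)] (s : ℝ) (x : SeqSpace p) :
    flNorm s p (toCoeff s x) = ‖x‖ₑ := by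
  simp only [enorm_eq_ellNorm, flNorm_eq_ellNorm, apply_eq_mul_toCoeff s x, enorm_mul,
    enorm_ofReal_abs_rpow]

theorem memℓp_mul_of_flNorm_lt_top [Fact (1 ≤ p)] {s : ℝ} {a : ℤ → ℂ} (h : flNorm s p a < ∞) :
    Memℓp (fun k : ZNonzero => ((|((k : ℤ) : ℝ)| ^ s : ℝ) : ℂ) * a k) (ENNReal.ofReal p) := by
  rw [memℓp_iff_ellNorm_lt_top exponent_pos]
  simpa only [enorm_mul, enorm_ofReal_abs_rpow, ← flNorm_eq_ellNorm] using h

/-- The element of `ℓ^p(ℤ₀)` which parametrizes a sequence with finite Fourier-Lebesgue norm. -/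
def ofCoeff [Fact (1 ≤ p)] (s : ℝ) (a : ℤ → ℂ) (h : flNorm s p a < ∞) : SeqSpace p :=
  ⟨_, memℓp_mul_of_flNorm_lt_top h⟩

theorem ofCoeff_apply [Fact (1 ≤ p)] {s : ℝ} {a : ℤ → ℂ} (h : flNorm s p a < ∞) (k : ZNonzero) :
    ofCoeff s a h k = ((|((k : ℤ) : ℝ)| ^ s : ℝ) : ℂ) * a k := rfl

theorem toCoeff_ofCoeff [Fact (1 ≤ p)] {s : ℝ} {a : ℤ → ℂ} (h0 : a 0 = 0)
    (h : flNorm s p a < ∞) : toCoeff s (ofCoeff s a h) = a := by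
  ext k
  rcases eq_or_ne k 0 with rfl | hk
  · rw [toCoeff_zero_freq, h0]
  · have hcancel := ofReal_abs_rpow_mul_cancel (-s) ⟨k, hk⟩ (a k)
    rw [neg_neg] at hcancel
    rw [toCoeff_apply s _ ⟨k, hk⟩, ofCoeff_apply, hcancel]

variable [Fact (1 ≤ p)]

/-- The Fourier multiplier with bounded symbol `c`. -/
def multiplier (c : ℤ → ℂ) {C : ℝ≥0} (hc : ∀ k, ‖c k‖ ≤ C) : SeqSpace p →L[ℂ] SeqSpace p :=
  lp.mapCLM _ (fun k : ZNonzero => ContinuousLinearMap.mul ℂ ℂ (c k)) C.coe_nonneg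
    fun k => by simpa using hc k

theorem multiplier_apply (c : ℤ → ℂ) {C : ℝ≥0} (hc : ∀ k, ‖c k‖ ≤ C) (x : SeqSpace p)
    (k : ZNonzero) : multiplier c hc x k = c k * x k := rfl

theorem toCoeff_multiplier (s : ℝ) (c : ℤ → ℂ) {C : ℝ≥0} (hc : ∀ k, ‖c k‖ ≤ C)
    (x : SeqSpace p) : toCoeff s (multiplier c hc x) = fun k => c k * toCoeff s x k := by
  ext k
  rcases eq_or_ne k 0 with rfl | hk
  · rw [toCoeff_zero_freq, toCoeff_zero_freq, mul_zero]
  · rw [toCoeff_apply s _ ⟨k, hk⟩, toCoeff_apply s _ ⟨k, hk⟩, multiplier_apply, mul_left_comm]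

/-! ### The linear propagator -/

/-- The symbol `e^{-ik²t}` of the propagator of the linear Schrödinger equation. -/
def phase (t : ℝ) (k : ℤ) : ℂ := Complex.exp (-Complex.I * (k : ℂ) ^ 2 * (t : ℂ))

theorem norm_phase (t : ℝ) (k : ℤ) : ‖phase t k‖ = 1 := by
  have hphase : phase t k = Complex.exp (((-(k : ℝ) ^ 2 * t : ℝ) : ℂ) * Complex.I) := by
    unfold phase
    congr 1
    push_cast
    ring
  rw [hphase, Complex.norm_exp_ofReal_mul_I]

theorem enorm_phase (t : ℝ) (k : ℤ) : ‖phase t k‖ₑ = 1 := by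
  rw [← ofReal_norm, norm_phase, ENNReal.ofReal_one]

theorem continuous_phase (k : ℤ) : Continuous fun t => phase t k := by
  unfold phase
  fun_prop

/-- The propagator of the linear Schrödinger equation on Fourier coefficients. -/
def propagator (t : ℝ) : SeqSpace p →L[ℂ] SeqSpace p :=
  multiplier (C := 1) (phase t) fun k => (norm_phase t k).le

theorem propagator_apply (t : ℝ) (x : SeqSpace p) (k : ZNonzero) :
    propagator t x k = phase t k * x k := rfl

theorem toCoeff_propagator (s t : ℝ) (x : SeqSpace p) :
    toCoeff s (propagator t x) = fun k => phase t k * toCoeff s x k :=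
  toCoeff_multiplier s _ _ x

theorem norm_propagator (t : ℝ) (x : SeqSpace p) : ‖propagator t x‖ = ‖x‖ := by
  have hnorm : ∀ k, ‖propagator t x k‖ = ‖x k‖ := fun k => by
    rw [propagator_apply, norm_mul, norm_phase, one_mul]
  have hp : ENNReal.ofReal p ≠ 0 := (ENNReal.ofReal_pos.2 exponent_pos).ne'
  exact le_antisymm (lp.norm_mono hp fun k => (hnorm k).le) (lp.norm_mono hp fun k => (hnorm k).ge)

theorem isometry_propagator (t : ℝ) : Isometry (propagator (p := p) t) :=
  AddMonoidHomClass.isometry_of_norm _ (norm_propagator t)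

theorem continuous_propagator_single [DecidableEq ZNonzero] (k : ZNonzero) (z : ℂ) :
    Continuous fun t =>
      propagator t (lp.single (E := fun _ : ZNonzero => ℂ) (ENNReal.ofReal p) k z) := by
  have hsmul : ∀ t, propagator t (lp.single (E := fun _ : ZNonzero => ℂ) (ENNReal.ofReal p) k z)
      = phase t k • lp.single (E := fun _ : ZNonzero => ℂ) (ENNReal.ofReal p) k z := by
    refine fun t => lp.ext (funext fun l => ?_)
    rw [propagator_apply, lp.coeFn_smul, Pi.smul_apply, smul_eq_mul]
    rcases eq_or_ne l k with rfl | hl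
    · rfl
    · rw [lp.single_apply_ne _ _ _ hl, mul_zero, mul_zero]
  simp only [hsmul]
  exact (continuous_phase k).smul continuous_const

/-- The propagators are isometries, so it suffices to consider finitely supported `x`. -/
theorem continuous_propagator_apply (x : SeqSpace p) : Continuous fun t => propagator t x := by
  classical
  have hsum := lp.hasSum_single (E := fun _ : ZNonzero => ℂ) (p := ENNReal.ofReal p)
    ENNReal.ofReal_ne_top x
  have huniform : TendstoUniformly
      (fun (u : Finset ZNonzero) t =>
        propagator t (∑ k ∈ u, lp.single (E := fun _ : ZNonzero => ℂ) (ENNReal.ofReal p) k (x k)))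
      (fun t => propagator t x) atTop := by
    rw [Metric.tendstoUniformly_iff]
    intro ε hε
    filter_upwards [Metric.tendsto_nhds.1 hsum ε hε] with u hu t
    rwa [dist_comm, (isometry_propagator t).dist_eq]
  refine huniform.continuous (Frequently.of_forall fun u => ?_)
  simp only [map_sum]
  exact continuous_finsetSum _ fun k _ => continuous_propagator_single k (x k)

theorem continuous_propagator :
    Continuous fun q : ℝ × SeqSpace p => propagator q.1 q.2 :=
  continuous_prod_of_continuous_lipschitzWith' _ 1 (fun t => (isometry_propagator t).lipschitz)
    continuous_propagator_apply

/-- The nonlinearity `G` conjugated by the linear flow. -/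
def interaction (G : SeqSpace p → SeqSpace p) (t : ℝ) (x : SeqSpace p) : SeqSpace p :=
  propagator (-t) (G (propagator t x))

theorem isSmallLipschitz_interaction {G : SeqSpace p → SeqSpace p} {ρ : ℝ} (h0 : G 0 = 0)
    (hG : LipschitzOnWith (1 / 8) G (Metric.closedBall 0 ρ)) :
    IsSmallLipschitz ρ (interaction G) := by
  have hball : ∀ t, ∀ x ∈ Metric.closedBall (0 : SeqSpace p) ρ,
      propagator t x ∈ Metric.closedBall (0 : SeqSpace p) ρ := fun t x hx => by
    simpa [norm_propagator] using hx
  refine ⟨fun t => by simp [interaction, h0], fun t x y hx hy => ?_, ?_⟩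
  · have hlip := hG.dist_le_mul _ (hball t x (by simpa using hx)) _
      (hball t y (by simpa using hy))
    rw [(isometry_propagator t).dist_eq, ← (isometry_propagator (-t)).dist_eq] at hlip
    simpa [dist_eq_norm, interaction] using hlip
  · have hinner : ContinuousOn (fun q : ℝ × SeqSpace p => G (propagator q.1 q.2))
        (univ ×ˢ Metric.closedBall (0 : SeqSpace p) ρ) :=
      hG.continuousOn.comp continuous_propagator.continuousOn fun q hq => hball _ _ hq.2
    have houter := continuous_propagator.comp_continuousOn
      (continuous_fst.neg.continuousOn.prodMk hinner)
    simpa only [Function.comp_def, Function.uncurry_def, Pi.neg_apply, interaction] using houter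

end SeqSpace

/-! ### Multilinear estimates -/

/-- The scalar factor in front of the `n`-th term of the normal form equation. -/
def termFactor (n : ℕ) (m : ℤ) : ℂ := (-1) ^ n * (m : ℂ) / (2 ^ (n - 1) * (n.factorial : ℂ))

/-- The `n`-linear map, on Fourier coefficients, whose diagonal is `𝒩ⁿ(0)`. -/
def termMulti {n : ℕ} (a : Fin n → ℤ → ℂ) (m : ℤ) : ℂ :=
  termFactor n m * ∑' k : Freq n m, ∏ j, a j (k.1 j) / (k.1 j : ℂ)

theorem termN_zero_time (n : ℕ) (a : ℤ → ℂ) : termN n 0 a = termMulti fun _ : Fin n => a := by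
  ext m
  simp [termN, termMulti, termFactor, summandN]

theorem termMulti_zero_freq {n : ℕ} (a : Fin n → ℤ → ℂ) : termMulti a 0 = 0 := by
  simp [termMulti, termFactor]

theorem enorm_termFactor_le (n : ℕ) (m : ℤ) : ‖termFactor n m‖ₑ ≤ ‖(m : ℂ)‖ₑ := by
  rw [enorm_le_iff_norm_le, termFactor, norm_div, norm_mul, norm_pow, norm_neg, norm_one, one_pow,
    one_mul, norm_mul, norm_pow, Complex.norm_ofNat, Complex.norm_natCast]
  refine div_le_self (norm_nonneg _) (one_le_mul_of_one_le_of_one_le ?_ ?_)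
  · exact one_le_pow₀ one_le_two
  · exact_mod_cast n.factorial_pos

theorem enorm_prod_div {n : ℕ} {m : ℤ} (a : Fin n → ℤ → ℂ) (k : Freq n m) :
    ‖∏ j, a j (k.1 j) / (k.1 j : ℂ)‖ₑ = ∏ j, ‖a j (k.1 j)‖ₑ / ‖(k.1 j : ℂ)‖ₑ := by
  rw [← ofReal_norm, norm_prod, ENNReal.ofReal_prod_of_nonneg fun _ _ => norm_nonneg _]
  refine Finset.prod_congr rfl fun j _ => ?_
  rw [ofReal_norm, div_eq_mul_inv, enorm_mul, enorm_inv (by simpa using k.2.1 j), div_eq_mul_inv]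

theorem enorm_termMulti_le {n : ℕ} (a : Fin n → ℤ → ℂ) (m : ℤ) :
    ‖termMulti a m‖ₑ ≤ convMajorant a m := by
  rw [termMulti, enorm_mul]
  refine mul_le_mul' (enorm_termFactor_le n m) (enorm_tsum_le_tsum_enorm.trans_eq ?_)
  exact tsum_congr fun k => enorm_prod_div a k

/-- The Fourier-Lebesgue norm with weight `truncWeight s σ N` in place of `|k|^s`. -/
def truncNorm (s σ : ℝ) (N : ℝ≥0∞) (p : ℝ) (a : ℤ → ℂ) : ℝ≥0∞ :=
  ellNorm p (fun k : ZNonzero => truncWeight s σ N k * ‖a k‖ₑ)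

theorem truncNorm_zero_exponent (s : ℝ) (N : ℝ≥0∞) (p : ℝ) (a : ℤ → ℂ) :
    truncNorm s 0 N p a = flNorm s p a := by
  simp only [truncNorm, truncWeight_zero_exponent, flNorm_eq_ellNorm]

theorem truncNorm_one (s σ p : ℝ) (a : ℤ → ℂ) : truncNorm s σ 1 p a = flNorm s p a := by
  simp only [truncNorm, truncWeight, min_eq_right (one_le_enorm_znonzero _), ENNReal.one_rpow,
    mul_one, flNorm_eq_ellNorm]

theorem flNorm_add_eq_iSup_truncNorm {σ p : ℝ} (s : ℝ) (hσ : 0 ≤ σ) (hp : 0 < p) (a : ℤ → ℂ) :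
    flNorm (s + σ) p a = ⨆ N : ℝ≥0, truncNorm s σ N p a := by
  have hadd : ∀ k : ZNonzero, ‖((k : ℤ) : ℂ)‖ₑ ^ (s + σ)
      = ‖((k : ℤ) : ℂ)‖ₑ ^ s * ‖((k : ℤ) : ℂ)‖ₑ ^ σ := fun k =>
    ENNReal.rpow_add _ _ (enorm_znonzero_ne_zero k) enorm_ne_top
  refine le_antisymm ?_ (iSup_le fun N => ?_)
  · rw [flNorm_eq_ellNorm, ellNorm_le_iff_sum hp]
    intro u
    let N : ℝ≥0 := ∑ k ∈ u, ‖((k : ℤ) : ℂ)‖₊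
    have hN : ∀ k ∈ u, ‖((k : ℤ) : ℂ)‖ₑ ≤ N := fun k hk => by
      rw [enorm_eq_nnnorm, ENNReal.coe_le_coe]
      exact Finset.single_le_sum (f := fun k : ZNonzero => ‖((k : ℤ) : ℂ)‖₊)
        (fun _ _ => zero_le) hk
    calc ∑ k ∈ u, (‖((k : ℤ) : ℂ)‖ₑ ^ (s + σ) * ‖a k‖ₑ) ^ p
        = ∑ k ∈ u, (truncWeight s σ N k * ‖a k‖ₑ) ^ p :=
          Finset.sum_congr rfl fun k hk => by rw [truncWeight, min_eq_left (hN k hk), hadd]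
      _ ≤ truncNorm s σ N p a ^ p := (ellNorm_le_iff_sum hp).1 le_rfl u
      _ ≤ (⨆ N : ℝ≥0, truncNorm s σ N p a) ^ p := by
          gcongr
          exact le_iSup (fun N : ℝ≥0 => truncNorm s σ N p a) N
  · rw [flNorm_eq_ellNorm]
    refine ellNorm_mono hp.le fun k => ?_
    rw [hadd, truncWeight]
    gcongr
    exact min_le_left _ _

theorem summable_rpow_mul_geometric (b : ℝ) :
    Summable fun n : ℕ => ((n + 2 : ℕ) : ℝ) ^ b * (2⁻¹ : ℝ) ^ n := by
  obtain ⟨k, hk⟩ := exists_nat_ge b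
  have hpow := summable_pow_mul_geometric_of_norm_lt_one k (r := (2⁻¹ : ℝ)) (by norm_num)
  refine Summable.of_nonneg_of_le (fun n => by positivity) (fun n => ?_)
    (((summable_nat_add_iff 2).2 hpow).mul_left 4)
  calc ((n + 2 : ℕ) : ℝ) ^ b * (2⁻¹ : ℝ) ^ n ≤ ((n + 2 : ℕ) : ℝ) ^ (k : ℝ) * (2⁻¹ : ℝ) ^ n := by
        gcongr
        exact_mod_cast Nat.one_le_iff_ne_zero.2 (by lia)
    _ = 4 * (((n + 2 : ℕ) : ℝ) ^ k * 2⁻¹ ^ (n + 2)) := by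
        rw [Real.rpow_natCast]
        ring

theorem eventually_tsum_rpow_mul_pow_le (b : ℝ) (D : ℝ≥0) {ε : ℝ≥0∞} (hε : 0 < ε) :
    ∀ᶠ r in 𝓝 (0 : ℝ≥0∞),
      ∑' n : ℕ, ((n + 2 : ℕ) : ℝ≥0∞) ^ b * (D * r) ^ (n + 1) ≤ ε := by
  set S : ℝ≥0∞ := ∑' n : ℕ, ((n + 2 : ℕ) : ℝ≥0∞) ^ b * 2⁻¹ ^ n
  have hS : S ≠ ∞ := by
    convert (summable_rpow_mul_geometric b).tsum_ofReal_ne_top using 4 with n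
    rw [ENNReal.ofReal_mul (by positivity), ENNReal.ofReal_pow (by positivity),
      ← ENNReal.ofReal_rpow_of_pos (by positivity), ENNReal.ofReal_natCast,
      ENNReal.ofReal_inv_of_pos two_pos, ENNReal.ofReal_ofNat]
  have hD : Tendsto (fun r : ℝ≥0∞ => D * r) (𝓝 0) (𝓝 0) := by
    have hlim := ENNReal.Tendsto.const_mul (a := (D : ℝ≥0∞)) (tendsto_id (x := 𝓝 (0 : ℝ≥0∞)))
      (.inr ENNReal.coe_ne_top)
    simpa only [id_eq, mul_zero] using hlim
  have hSD : Tendsto (fun r : ℝ≥0∞ => S * (D * r)) (𝓝 0) (𝓝 0) := by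
    simpa using ENNReal.Tendsto.const_mul hD (.inr hS)
  filter_upwards [hD.eventually_le_const (u := 2⁻¹) (by simp), hSD.eventually_le_const hε]
    with r hr hSr
  refine le_trans ?_ hSr
  rw [← ENNReal.tsum_mul_right]
  refine ENNReal.tsum_le_tsum fun n => ?_
  rw [pow_succ, ← mul_assoc]
  gcongr

section Estimates

variable {s p : ℝ} {C : ℝ≥0}

theorem EmbedsInL2.ellNorm_truncWeight_mul_convMajorant_le (h : EmbedsInL2 s p C) {σ : ℝ}
    (hσ : 0 ≤ σ) (N : ℝ≥0∞) {n : ℕ} (a : Fin (n + 1) → ℤ → ℂ) :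
    ellNorm p (fun m : ZNonzero => truncWeight s σ N m * convMajorant a m)
      ≤ ((n + 1 : ℕ) : ℝ≥0∞) ^ (1 + s + σ) * ∑ i, truncNorm s σ N p (a i) *
          ∏ j, ((C * invWeightNorm : ℝ≥0) * flNorm s p (a (i.succAbove j))) := by
  refine (ellNorm_mul_convMajorant_le h.one_le_exponent
    (truncWeight_sum_mul_enorm_le h.regularity_nonneg hσ N) a).trans ?_
  gcongr with i _ j
  · exact le_rfl
  · exact h.tsum_enorm_div_le _

theorem natCast_rpow_add_one (n : ℕ) {r : ℝ} (hr : 0 ≤ r) :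
    (n : ℝ≥0∞) ^ (r + 1) = (n : ℝ≥0∞) ^ r * n := by
  rw [ENNReal.rpow_add_of_nonneg _ _ hr zero_le_one, ENNReal.rpow_one]

theorem EmbedsInL2.truncNorm_termN_zero_le (h : EmbedsInL2 s p C) {σ : ℝ} (hσ : 0 ≤ σ)
    (N : ℝ≥0∞) (n : ℕ) (a : ℤ → ℂ) :
    truncNorm s σ N p (termN (n + 1) 0 a)
      ≤ ((n + 1 : ℕ) : ℝ≥0∞) ^ (1 + s + σ + 1) *
          ((C * invWeightNorm : ℝ≥0) * flNorm s p a) ^ n * truncNorm s σ N p a := by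
  have hs := h.regularity_nonneg
  rw [termN_zero_time]
  refine le_trans (ellNorm_mono h.exponent_pos.le fun m => ?_)
    ((h.ellNorm_truncWeight_mul_convMajorant_le hσ N fun _ : Fin (n + 1) => a).trans_eq ?_)
  · gcongr
    exact enorm_termMulti_le _ _
  · simp only [Finset.prod_const, Finset.sum_const, Finset.card_univ, Fintype.card_fin,
      nsmul_eq_mul]
    rw [natCast_rpow_add_one _ (by positivity)]
    ring

theorem EmbedsInL2.eventually_tsum_truncNorm_termN_zero_le (h : EmbedsInL2 s p C) {σ : ℝ}
    (hσ : 0 ≤ σ) {ε : ℝ≥0∞} (hε : 0 < ε) :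
    ∀ᶠ r in 𝓝 (0 : ℝ≥0∞), ∀ a : ℤ → ℂ, flNorm s p a ≤ r → ∀ N : ℝ≥0∞,
      ∑' n : ℕ, truncNorm s σ N p (termN (n + 2) 0 a) ≤ ε * truncNorm s σ N p a := by
  filter_upwards [eventually_tsum_rpow_mul_pow_le (1 + s + σ + 1) (C * invWeightNorm) hε]
    with r hr a ha N
  refine le_trans ?_ (mul_le_mul_left hr _)
  rw [← ENNReal.tsum_mul_right]
  refine ENNReal.tsum_le_tsum fun n => (h.truncNorm_termN_zero_le hσ N (n + 1) a).trans ?_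
  gcongr

theorem EmbedsInL2.ellNorm_rpow_mul_convMajorant_le (h : EmbedsInL2 s p C) {n : ℕ}
    (a : Fin (n + 1) → ℤ → ℂ) :
    ellNorm p (fun m : ZNonzero => ‖((m : ℤ) : ℂ)‖ₑ ^ s * convMajorant a m)
      ≤ ((n + 1 : ℕ) : ℝ≥0∞) ^ (1 + s + 1) * (C * invWeightNorm : ℝ≥0) ^ n *
          ∏ j, flNorm s p (a j) := by
  have hs := h.regularity_nonneg
  have htrunc := h.ellNorm_truncWeight_mul_convMajorant_le le_rfl 0 a
  simp only [truncWeight_zero_exponent, truncNorm_zero_exponent, Finset.prod_mul_distrib,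
    Finset.prod_const, Finset.card_univ, Fintype.card_fin, add_zero] at htrunc
  refine htrunc.trans_eq ?_
  have hfactor : ∀ i, flNorm s p (a i) * (((C * invWeightNorm : ℝ≥0) : ℝ≥0∞) ^ n *
      ∏ j, flNorm s p (a (i.succAbove j)))
        = ((C * invWeightNorm : ℝ≥0) : ℝ≥0∞) ^ n * ∏ j, flNorm s p (a j) := fun i => by
    rw [Fin.prod_univ_succAbove _ i, mul_left_comm]
  simp only [hfactor, Finset.sum_const, Finset.card_univ, Fintype.card_fin, nsmul_eq_mul]
  rw [natCast_rpow_add_one _ (by positivity)]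
  ring

theorem EmbedsInL2.flNorm_termMulti_le (h : EmbedsInL2 s p C) {n : ℕ} (a : Fin (n + 1) → ℤ → ℂ) :
    flNorm s p (termMulti a)
      ≤ ((n + 1 : ℕ) : ℝ≥0∞) ^ (1 + s + 1) * (C * invWeightNorm : ℝ≥0) ^ n *
          ∏ j, flNorm s p (a j) := by
  rw [flNorm_eq_ellNorm]
  refine (ellNorm_mono h.exponent_pos.le fun m => ?_).trans (h.ellNorm_rpow_mul_convMajorant_le a)
  gcongr
  exact enorm_termMulti_le _ _

theorem EmbedsInL2.summable_prod_div (h : EmbedsInL2 s p C) {n : ℕ} {a : Fin (n + 1) → ℤ → ℂ}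
    (ha : ∀ j, flNorm s p (a j) < ∞) {m : ℤ} (hm : m ≠ 0) :
    Summable fun k : Freq (n + 1) m => ∏ j, a j (k.1 j) / (k.1 j : ℂ) := by
  have hs := h.regularity_nonneg
  have hfinite : ‖(m : ℂ)‖ₑ ^ s * convMajorant a m < ∞ := by
    have hle := le_ellNorm h.exponent_pos
      (fun m : ZNonzero => ‖((m : ℤ) : ℂ)‖ₑ ^ s * convMajorant a m) ⟨m, hm⟩
    refine (hle.trans (h.ellNorm_rpow_mul_convMajorant_le a)).trans_lt ?_
    refine ENNReal.mul_lt_top (ENNReal.mul_lt_top ?_ ?_) (ENNReal.prod_lt_top fun j _ => ha j)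
    · exact ENNReal.rpow_lt_top_of_nonneg (by positivity) (ENNReal.natCast_ne_top _)
    · exact ENNReal.pow_lt_top ENNReal.coe_lt_top
  refine Summable.of_enorm fun htop => ?_
  simp only [enorm_prod_div] at htop
  have hm0 : ‖(m : ℂ)‖ₑ ≠ 0 := enorm_znonzero_ne_zero ⟨m, hm⟩
  rw [convMajorant, htop, ENNReal.mul_top hm0, ENNReal.mul_top] at hfinite
  · exact lt_irrefl _ hfinite
  · simp [ENNReal.rpow_eq_zero_iff, hm0]

end Estimates

/-! ### The nonlinearities at time zero -/

/-- The product `∏_j f_j(k_j) / k_j`, as a function of the parameters of `f_1, …, f_n`. -/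
def freqProduct (s p : ℝ) {n : ℕ} (k : Fin n → ℤ) :
    MultilinearMap ℂ (fun _ : Fin n => SeqSpace p) ℂ :=
  (MultilinearMap.mkPiAlgebra ℂ (Fin n) ℂ).compLinearMap fun j =>
    (k j : ℂ)⁻¹ • (LinearMap.proj (k j)).comp (toCoeff s)

theorem freqProduct_apply {s p : ℝ} {n : ℕ} (k : Fin n → ℤ) (x : Fin n → SeqSpace p) :
    freqProduct s p k x = ∏ j, toCoeff s (x j) (k j) / (k j : ℂ) := by
  simp [freqProduct, div_eq_inv_mul]

theorem termMulti_toCoeff {s p : ℝ} {n : ℕ} (x : Fin n → SeqSpace p) (m : ℤ) :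
    termMulti (fun j => toCoeff s (x j)) m
      = termFactor n m * ∑' k : Freq n m, freqProduct s p k.1 x := by
  simp only [termMulti, freqProduct_apply]

section Nonlinearities

variable {s p : ℝ} {C : ℝ≥0}

namespace EmbedsInL2

/-- The constant in the estimate of the `(n + 1)`-linear term. -/
def multiBound (_ : EmbedsInL2 s p C) (n : ℕ) : ℝ≥0 :=
  ((n + 1 : ℕ) : ℝ≥0) ^ (1 + s + 1) * (C * invWeightNorm) ^ n

theorem coe_multiBound (h : EmbedsInL2 s p C) (n : ℕ) :
    (h.multiBound n : ℝ≥0∞)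
      = ((n + 1 : ℕ) : ℝ≥0∞) ^ (1 + s + 1) * (C * invWeightNorm : ℝ≥0) ^ n := by
  have hs := h.regularity_nonneg
  rw [multiBound, ENNReal.coe_mul, ENNReal.coe_rpow_of_nonneg _ (by positivity), ENNReal.coe_pow,
    ENNReal.coe_natCast]

end EmbedsInL2

variable [Fact (1 ≤ p)]

theorem flNorm_toCoeff_lt_top (s : ℝ) (x : SeqSpace p) : flNorm s p (toCoeff s x) < ∞ := by
  rw [flNorm_toCoeff]
  exact enorm_lt_top

namespace EmbedsInL2

theorem summable_freqProduct (h : EmbedsInL2 s p C) {n : ℕ} (x : Fin (n + 1) → SeqSpace p) {m : ℤ}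
    (hm : m ≠ 0) : Summable fun k : Freq (n + 1) m => freqProduct s p k.1 x := by
  simpa only [freqProduct_apply] using
    h.summable_prod_div (fun j => flNorm_toCoeff_lt_top s (x j)) hm

theorem flNorm_termMulti_toCoeff_le (h : EmbedsInL2 s p C) {n : ℕ}
    (x : Fin (n + 1) → SeqSpace p) :
    flNorm s p (termMulti fun j => toCoeff s (x j)) ≤ h.multiBound n * ∏ j, ‖x j‖ₑ := by
  simpa only [h.coe_multiBound, flNorm_toCoeff] using
    h.flNorm_termMulti_le fun j => toCoeff s (x j)

theorem flNorm_termMulti_toCoeff_lt_top (h : EmbedsInL2 s p C) {n : ℕ}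
    (x : Fin (n + 1) → SeqSpace p) :
    flNorm s p (termMulti fun j => toCoeff s (x j)) < ∞ :=
  (h.flNorm_termMulti_toCoeff_le x).trans_lt
    (ENNReal.mul_lt_top ENNReal.coe_lt_top (ENNReal.prod_lt_top fun _ _ => enorm_lt_top))

/-- The multilinear map on `ℓ^p(ℤ₀)` which corresponds to `termMulti`. -/
def termMultilinear (h : EmbedsInL2 s p C) (n : ℕ) :
    MultilinearMap ℂ (fun _ : Fin (n + 1) => SeqSpace p) (SeqSpace p) where
  toFun x := ofCoeff s (termMulti fun j => toCoeff s (x j)) (h.flNorm_termMulti_toCoeff_lt_top x)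
  map_update_add' x i u v := by
    refine lp.ext (funext fun m => ?_)
    rw [lp.coeFn_add, Pi.add_apply]
    simp only [ofCoeff_apply, termMulti_toCoeff, MultilinearMap.map_update_add]
    rw [(h.summable_freqProduct _ m.2).tsum_add (h.summable_freqProduct _ m.2)]
    ring
  map_update_smul' x i c u := by
    refine lp.ext (funext fun m => ?_)
    rw [lp.coeFn_smul, Pi.smul_apply]
    simp only [ofCoeff_apply, termMulti_toCoeff, MultilinearMap.map_update_smul, smul_eq_mul,
      tsum_mul_left]
    ring

theorem toCoeff_termMultilinear (h : EmbedsInL2 s p C) {n : ℕ} (x : Fin (n + 1) → SeqSpace p) :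
    toCoeff s (h.termMultilinear n x) = termMulti fun j => toCoeff s (x j) :=
  toCoeff_ofCoeff (termMulti_zero_freq _) (h.flNorm_termMulti_toCoeff_lt_top x)

theorem norm_termMultilinear_le (h : EmbedsInL2 s p C) {n : ℕ} (x : Fin (n + 1) → SeqSpace p) :
    ‖h.termMultilinear n x‖ ≤ h.multiBound n * ∏ j, ‖x j‖ := by
  have hle : ‖h.termMultilinear n x‖ₑ ≤ h.multiBound n * ∏ j, ‖x j‖ₑ := by
    rw [← flNorm_toCoeff s, toCoeff_termMultilinear]
    exact h.flNorm_termMulti_toCoeff_le x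
  simp only [enorm_eq_nnnorm] at hle
  have hle' : ‖h.termMultilinear n x‖₊ ≤ h.multiBound n * ∏ j, ‖x j‖₊ := by exact_mod_cast hle
  simpa using NNReal.coe_le_coe.2 hle'

/-- The power series `∑_{n ≥ 2} 𝒩ⁿ(0)` on `ℓ^p(ℤ₀)`. -/
def normalSeries (h : EmbedsInL2 s p C) : FormalMultilinearSeries ℂ (SeqSpace p) (SeqSpace p)
  | 0 => 0
  | 1 => 0
  | n + 2 => (h.termMultilinear (n + 1)).mkContinuous _ h.norm_termMultilinear_le

theorem toCoeff_normalSeries (h : EmbedsInL2 s p C) (n : ℕ) (x : SeqSpace p) :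
    toCoeff s (h.normalSeries (n + 2) fun _ => x) = termN (n + 2) 0 (toCoeff s x) := by
  rw [termN_zero_time]
  exact h.toCoeff_termMultilinear fun _ => x

theorem nnnorm_normalSeries_le (h : EmbedsInL2 s p C) (n : ℕ) :
    ‖h.normalSeries (n + 2)‖₊ ≤ h.multiBound (n + 1) :=
  MultilinearMap.mkContinuous_norm_le _ (h.multiBound (n + 1)).coe_nonneg
    h.norm_termMultilinear_le

theorem normalSeries_radius_pos (h : EmbedsInL2 s p C) : 0 < h.normalSeries.radius := by
  obtain ⟨r₀, hr₀, hsum_le⟩ := ENNReal.nhds_zero_basis_Iic.eventually_iff.1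
    (eventually_tsum_rpow_mul_pow_le (1 + s + 1) (C * invWeightNorm) one_pos)
  obtain ⟨r, hr, hrr₀⟩ := ENNReal.lt_iff_exists_nnreal_btwn.1 hr₀
  refine (ENNReal.coe_pos.2 (ENNReal.coe_pos.1 hr)).trans_le
    (h.normalSeries.le_radius_of_summable_nnnorm ((NNReal.summable_nat_add_iff 2).1 ?_))
  have hsummable : Summable fun n => h.multiBound (n + 1) * r ^ (n + 1) := by
    rw [← ENNReal.tsum_coe_ne_top_iff_summable]
    simpa only [ENNReal.coe_mul, h.coe_multiBound, ENNReal.coe_pow, mul_assoc, ← mul_pow]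
      using ((hsum_le hrr₀.le).trans_lt ENNReal.one_lt_top).ne
  refine NNReal.summable_of_le (fun n => ?_) (hsummable.mul_right r)
  rw [mul_assoc, ← pow_succ]
  gcongr
  exact h.nnnorm_normalSeries_le n

/-- The nonlinearity `∑_{n ≥ 2} 𝒩ⁿ(0)` on `ℓ^p(ℤ₀)`. -/
def normalSum (h : EmbedsInL2 s p C) (x : SeqSpace p) : SeqSpace p := h.normalSeries.sum x

theorem hasFPowerSeriesAt_normalSum (h : EmbedsInL2 s p C) :
    HasFPowerSeriesAt h.normalSum h.normalSeries 0 :=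
  ⟨_, h.normalSeries.hasFPowerSeriesOnBall h.normalSeries_radius_pos⟩

theorem normalSum_zero (h : EmbedsInL2 s p C) : h.normalSum 0 = 0 :=
  (h.hasFPowerSeriesAt_normalSum.coeff_zero fun _ => 0).symm

theorem hasStrictFDerivAt_normalSum (h : EmbedsInL2 s p C) :
    HasStrictFDerivAt (𝕜 := ℂ) h.normalSum 0 0 := by
  have hderiv := h.hasFPowerSeriesAt_normalSum.hasStrictFDerivAt
  rwa [show h.normalSeries 1 = 0 from rfl, map_zero] at hderiv

theorem eventually_hasSum_normalSum (h : EmbedsInL2 s p C) : ∀ᶠ x : SeqSpace p in 𝓝 0,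
    HasSum (fun n => h.normalSeries (n + 2) fun _ => x) (h.normalSum x) := by
  filter_upwards [h.hasFPowerSeriesAt_normalSum.eventually_hasSum] with x hx
  rw [zero_add] at hx
  simpa [Finset.sum_range_succ, normalSeries] using (hasSum_nat_add_iff' 2).2 hx

end EmbedsInL2

end Nonlinearities

section Mass

variable {s p : ℝ} {C : ℝ≥0} [Fact (1 ≤ p)]

namespace EmbedsInL2

theorem tsum_enorm_mul_neg_le (h : EmbedsInL2 s p C) (x y : SeqSpace p) :
    ∑' m : ZNonzero, ‖toCoeff s x m * toCoeff s y (-m)‖ₑ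
      ≤ (C ^ 2 : ℝ≥0) * (‖x‖ₑ * ‖y‖ₑ) := by
  have hreflect : ellNorm 2 (fun m : ZNonzero => ‖toCoeff s y (-m)‖ₑ)
      = ellNorm 2 (fun m : ZNonzero => ‖toCoeff s y m‖ₑ) := by
    let reflection : ZNonzero ≃ ZNonzero := (Equiv.neg ℤ).subtypeEquiv fun k => by simp
    rw [ellNorm, ellNorm, ← reflection.tsum_eq fun m : ZNonzero => ‖toCoeff s y m‖ₑ ^ (2 : ℝ)]
    rfl
  calc ∑' m : ZNonzero, ‖toCoeff s x m * toCoeff s y (-m)‖ₑ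
      ≤ ellNorm 2 (fun m : ZNonzero => ‖toCoeff s x m‖ₑ)
          * ellNorm 2 (fun m : ZNonzero => ‖toCoeff s y m‖ₑ) := by
        simp only [enorm_mul]
        rw [← hreflect]
        exact tsum_mul_le_ellNorm_two_mul _ _
    _ ≤ (C * ‖x‖ₑ) * (C * ‖y‖ₑ) := by
        rw [← flNorm_toCoeff s x, ← flNorm_toCoeff s y]
        exact mul_le_mul' (h.ellNorm_two_le _) (h.ellNorm_two_le _)
    _ = (C ^ 2 : ℝ≥0) * (‖x‖ₑ * ‖y‖ₑ) := by
        rw [ENNReal.coe_pow]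
        ring

theorem summable_mul_neg (h : EmbedsInL2 s p C) (x y : SeqSpace p) :
    Summable fun m : ZNonzero => toCoeff s x m * toCoeff s y (-m) :=
  Summable.of_enorm ((h.tsum_enorm_mul_neg_le x y).trans_lt
    (ENNReal.mul_lt_top ENNReal.coe_lt_top (ENNReal.mul_lt_top enorm_lt_top enorm_lt_top))).ne

theorem norm_tsum_mul_neg_le (h : EmbedsInL2 s p C) (x y : SeqSpace p) :
    ‖∑' m : ZNonzero, toCoeff s x m * toCoeff s y (-m)‖ ≤ (C ^ 2 : ℝ≥0) * ‖x‖ * ‖y‖ := by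
  have hle := enorm_tsum_le_tsum_enorm.trans (h.tsum_enorm_mul_neg_le x y)
  simp only [enorm_eq_nnnorm] at hle
  rw [mul_assoc]
  exact_mod_cast hle

/-- The bilinear form `∑_{m ≠ 0} f_m g_{-m}` polarizing `M`, in the parameters of `f` and `g`. -/
def massForm (h : EmbedsInL2 s p C) : SeqSpace p →L[ℂ] SeqSpace p →L[ℂ] ℂ :=
  LinearMap.mkContinuous₂
    (LinearMap.mk₂ ℂ (fun x y => ∑' m : ZNonzero, toCoeff s x m * toCoeff s y (-m))
      (fun x x' y => by
        simp only [map_add, Pi.add_apply, add_mul]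
        exact (h.summable_mul_neg x y).tsum_add (h.summable_mul_neg x' y))
      (fun c x y => by
        simp only [map_smul, Pi.smul_apply, smul_eq_mul, mul_assoc, tsum_mul_left])
      (fun x y y' => by
        simp only [map_add, Pi.add_apply, mul_add]
        exact (h.summable_mul_neg x y).tsum_add (h.summable_mul_neg x y'))
      (fun c x y => by
        simp only [map_smul, Pi.smul_apply, smul_eq_mul, mul_left_comm _ c, tsum_mul_left]))
    (C ^ 2 : ℝ≥0) h.norm_tsum_mul_neg_le

theorem massM_zero_toCoeff (h : EmbedsInL2 s p C) (x : SeqSpace p) :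
    massM 0 (toCoeff s x) = h.massForm x x := by
  simp [massM, summandM, massForm]

theorem norm_massForm_le (h : EmbedsInL2 s p C) (x y : SeqSpace p) :
    ‖h.massForm x y‖ ≤ (C ^ 2 : ℝ≥0) * ‖x‖ * ‖y‖ :=
  h.norm_tsum_mul_neg_le x y

/-- The nonlinearity `∑_{n ≥ 2} ℛⁿ(0)` on `ℓ^p(ℤ₀)`. -/
def resonantSum (h : EmbedsInL2 s p C) (x : SeqSpace p) : SeqSpace p :=
  (-(Complex.I / 4) * h.massForm x x) • (h.normalSum x - x)

theorem resonantSum_zero (h : EmbedsInL2 s p C) : h.resonantSum 0 = 0 := by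
  simp [resonantSum]

theorem hasStrictFDerivAt_resonantSum (h : EmbedsInL2 s p C) :
    HasStrictFDerivAt (𝕜 := ℂ) h.resonantSum 0 0 := by
  have hmass : HasStrictFDerivAt (𝕜 := ℂ) (fun x => h.massForm x x) _ 0 :=
    h.massForm.hasStrictFDerivAt.clm_apply (hasStrictFDerivAt_id 0)
  have hprod := (hmass.const_mul (-(Complex.I / 4))).smul
    (h.hasStrictFDerivAt_normalSum.sub (hasStrictFDerivAt_id 0))
  refine hprod.congr_fderiv ?_
  ext1 x
  simp [normalSum_zero]

end EmbedsInL2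

end Mass

/-! ### The nonlinearities at time `t` -/

theorem termN_one_zero_time (a : ℤ → ℂ) {m : ℤ} (hm : m ≠ 0) : termN 1 0 a m = -a m := by
  have hsingle : ∑' k : Freq 1 m, summandN 0 a k.1 = a m / m := by
    rw [tsum_eq_single (⟨fun _ => m, fun _ => hm, by simp⟩ : Freq 1 m)]
    · simp [summandN]
    · rintro ⟨k, hk, hkm⟩ hne
      refine absurd (Subtype.ext (funext fun j => ?_)) hne
      rwa [Fin.sum_univ_one, ← Subsingleton.elim j 0] at hkm
  have hmC : (m : ℂ) ≠ 0 := by exact_mod_cast hm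
  simp [termN, hsingle, mul_div_cancel₀ _ hmC]

theorem exp_modulation {n : ℕ} (t : ℝ) (k : Fin n → ℤ) :
    Complex.exp (Complex.I * (modulation k : ℂ) * (t : ℂ))
      = phase (-t) (∑ j, k j) * ∏ j, phase t (k j) := by
  simp only [phase, ← Complex.exp_sum, ← Complex.exp_add, modulation]
  congr 1
  push_cast
  rw [← Finset.sum_mul, ← Finset.mul_sum]
  ring

theorem summandN_eq_phase_mul {n : ℕ} (t : ℝ) (a : ℤ → ℂ) (k : Fin n → ℤ) :
    summandN t a k = phase (-t) (∑ j, k j) * ∏ j, phase t (k j) * a (k j) / (k j : ℂ) := by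
  rw [summandN, exp_modulation]
  simp only [mul_div_assoc, Finset.prod_mul_distrib, mul_assoc]

theorem termN_eq_phase_mul (n : ℕ) (t : ℝ) (a : ℤ → ℂ) :
    termN n t a = fun m => phase (-t) m * termN n 0 (fun l => phase t l * a l) m := by
  ext m
  have hsummand : ∀ k : Freq n m, summandN t a k.1
      = phase (-t) m * summandN 0 (fun l => phase t l * a l) k.1 := fun k => by
    rw [summandN_eq_phase_mul, k.2.2]
    simp [summandN]
  simp only [termN, hsummand, tsum_mul_left]
  ring

theorem summandM_eq_phase_mul (t : ℝ) (a : ℤ → ℂ) (m : ℤ) :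
    summandM t a m = phase t m * a m * (phase t (-m) * a (-m)) := by
  have hexp : Complex.exp (-2 * Complex.I * (m : ℂ) ^ 2 * (t : ℂ))
      = phase t m * phase t (-m) := by
    rw [phase, phase, ← Complex.exp_add]
    congr 1
    push_cast
    ring
  rw [summandM, hexp]
  ring

theorem massM_eq_zero_time (t : ℝ) (a : ℤ → ℂ) :
    massM t a = massM 0 fun l => phase t l * a l := by
  simp only [massM, summandM_eq_phase_mul t]
  simp [summandM]

theorem termR_eq_phase_mul (n : ℕ) (t : ℝ) (a : ℤ → ℂ) :
    termR n t a = fun m => phase (-t) m * termR n 0 (fun l => phase t l * a l) m := by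
  ext m
  rw [termR, termR, termN_eq_phase_mul, massM_eq_zero_time]
  ring

theorem flNorm_phase_mul (s p t : ℝ) (a : ℤ → ℂ) :
    flNorm s p (fun l => phase t l * a l) = flNorm s p a := by
  simp only [flNorm, enorm_mul, enorm_phase, one_mul]

theorem flNorm_termN_one (s p t : ℝ) (a : ℤ → ℂ) : flNorm s p (termN 1 t a) = flNorm s p a := by
  rw [termN_eq_phase_mul, flNorm_phase_mul, ← flNorm_phase_mul s p t a, flNorm, flNorm]
  congr! 4 with k
  rw [termN_one_zero_time _ k.2, enorm_neg]

section TimeDependent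

variable {s p : ℝ} {C : ℝ≥0} [Fact (1 ≤ p)]

/-- The functional `x ↦ |m|^{-s} x_m` which gives the `m`-th Fourier coefficient. -/
def coeffFunctional (s : ℝ) (m : ZNonzero) : SeqSpace p →L[ℂ] ℂ :=
  ((|((m : ℤ) : ℝ)| ^ (-s) : ℝ) : ℂ) •
    lp.evalCLM ℂ (fun _ : ZNonzero => ℂ) (ENNReal.ofReal p) m

theorem coeffFunctional_apply (s : ℝ) (m : ZNonzero) (x : SeqSpace p) :
    coeffFunctional s m x = toCoeff s x m := by
  rw [toCoeff_apply]
  rfl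

theorem toCoeff_interaction (s : ℝ) (G : SeqSpace p → SeqSpace p) (t : ℝ) (x : SeqSpace p) :
    toCoeff s (interaction G t x) = fun m => phase (-t) m * toCoeff s (G (propagator t x)) m :=
  toCoeff_propagator s (-t) _

namespace EmbedsInL2

theorem hasSum_termN_zero_time (h : EmbedsInL2 s p C) {x : SeqSpace p}
    (hx : HasSum (fun n => h.normalSeries (n + 2) fun _ => x) (h.normalSum x)) (m : ZNonzero) :
    HasSum (fun n => termN (n + 2) 0 (toCoeff s x) m) (toCoeff s (h.normalSum x) m) := by
  have hsum := hx.mapL (coeffFunctional s m)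
  simpa only [coeffFunctional_apply, toCoeff_normalSeries] using hsum

theorem hasSum_termR_zero_time (h : EmbedsInL2 s p C) {x : SeqSpace p}
    (hx : HasSum (fun n => h.normalSeries (n + 2) fun _ => x) (h.normalSum x)) (m : ZNonzero) :
    HasSum (fun n => termR (n + 2) 0 (toCoeff s x) m) (toCoeff s (h.resonantSum x) m) := by
  have hsum : HasSum (fun n => termN (n + 1) 0 (toCoeff s x) m)
      (toCoeff s (h.normalSum x - x) m) := by
    rw [← hasSum_nat_add_iff' 1]
    simpa [termN_one_zero_time _ m.2] using h.hasSum_termN_zero_time hx m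
  rw [resonantSum, map_smul, Pi.smul_apply, smul_eq_mul]
  simp only [termR, h.massM_zero_toCoeff]
  exact hsum.mul_left _

end EmbedsInL2

end TimeDependent

theorem eventually_lipschitzOnWith_closedBall {𝕜 E F : Type*} [NontriviallyNormedField 𝕜]
    [NormedAddCommGroup E] [NormedSpace 𝕜 E] [NormedAddCommGroup F] [NormedSpace 𝕜 F] {f : E → F}
    {x : E} (hf : HasStrictFDerivAt (𝕜 := 𝕜) f 0 x) {K : ℝ≥0} (hK : 0 < K) :
    ∀ᶠ ρ in 𝓝 (0 : ℝ), LipschitzOnWith K f (Metric.closedBall x ρ) := by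
  obtain ⟨u, hu, hlip⟩ := hf.exists_lipschitzOnWith_of_nnnorm_lt K (by simpa using hK)
  filter_upwards [(tendsto_closedBall_smallSets x).eventually (eventually_smallSets_subset.2 hu)]
    with ρ hρ
  exact hlip.mono hρ

theorem enorm_le_ofReal_iff {E : Type*} [SeminormedAddCommGroup E] {x : E} {r : ℝ} (hr : 0 ≤ r) :
    ‖x‖ₑ ≤ ENNReal.ofReal r ↔ ‖x‖ ≤ r := by
  rw [← ofReal_norm, ENNReal.ofReal_le_ofReal_iff hr]

section SmallRadius

variable {s p : ℝ} {C : ℝ≥0} [Fact (1 ≤ p)]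

/-- A radius `ρ` such that on the ball of radius `ρ` in `FL₀^{s,p}` all series converge and the
nonlinearities are small: in Lipschitz norm, and in every truncation of the norm of
`FL₀^{s+σ,p}`. -/
structure IsSmallRadius (h : EmbedsInL2 s p C) (σ ρ : ℝ) : Prop where
  pos : 0 < ρ
  hasSum_normalSum : ∀ x : SeqSpace p, ‖x‖ ≤ ρ →
    HasSum (fun n => h.normalSeries (n + 2) fun _ => x) (h.normalSum x)
  tsum_truncNorm_le : ∀ a : ℤ → ℂ, flNorm s p a ≤ ENNReal.ofReal ρ → ∀ N : ℝ≥0∞,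
    ∑' n : ℕ, truncNorm s σ N p (termN (n + 2) 0 a) ≤ (1 / 8 : ℝ≥0) * truncNorm s σ N p a
  sq_mul_sq_le : C ^ 2 * ρ ^ 2 ≤ 1 / 4
  lipschitz_normalSum : LipschitzOnWith (1 / 8) h.normalSum (Metric.closedBall 0 ρ)
  lipschitz_resonantSum : LipschitzOnWith (1 / 8) h.resonantSum (Metric.closedBall 0 ρ)

theorem eventually_isSmallRadius (h : EmbedsInL2 s p C) {σ : ℝ} (hσ : 0 ≤ σ) :
    ∀ᶠ ρ in 𝓝[>] (0 : ℝ), IsSmallRadius h σ ρ := by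
  have hzero : Tendsto (fun ρ : ℝ => (C : ℝ) ^ 2 * ρ ^ 2) (𝓝 0) (𝓝 0) :=
    Continuous.tendsto' (by fun_prop) _ _ (by simp)
  have hofReal : Tendsto ENNReal.ofReal (𝓝 0) (𝓝 0) :=
    ENNReal.continuous_ofReal.tendsto' _ _ ENNReal.ofReal_zero
  have hK : (0 : ℝ≥0) < 1 / 8 := by norm_num
  filter_upwards [self_mem_nhdsWithin,
    nhdsWithin_le_nhds ((tendsto_closedBall_smallSets 0).eventually
      (eventually_smallSets_forall.2 h.eventually_hasSum_normalSum)),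
    nhdsWithin_le_nhds (hofReal.eventually
      (h.eventually_tsum_truncNorm_termN_zero_le hσ (ε := (1 / 8 : ℝ≥0)) (by simp))),
    nhdsWithin_le_nhds (hzero.eventually_le_const (by norm_num : (0 : ℝ) < 1 / 4)),
    nhdsWithin_le_nhds
      (eventually_lipschitzOnWith_closedBall h.hasStrictFDerivAt_normalSum hK),
    nhdsWithin_le_nhds
      (eventually_lipschitzOnWith_closedBall h.hasStrictFDerivAt_resonantSum hK)]
    with ρ hpos hsum htrunc hsq hlipN hlipR
  exact ⟨hpos, fun x hx => hsum x (by simpa using hx), htrunc, hsq, hlipN, hlipR⟩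

namespace IsSmallRadius

variable {h : EmbedsInL2 s p C} {σ ρ : ℝ} {x : SeqSpace p}

theorem isSmallLipschitz_normalSum (hρ : IsSmallRadius h σ ρ) :
    IsSmallLipschitz ρ (interaction h.normalSum) :=
  isSmallLipschitz_interaction h.normalSum_zero hρ.lipschitz_normalSum

theorem isSmallLipschitz_resonantSum (hρ : IsSmallRadius h σ ρ) :
    IsSmallLipschitz ρ (interaction h.resonantSum) :=
  isSmallLipschitz_interaction h.resonantSum_zero hρ.lipschitz_resonantSum

theorem norm_massForm_le (hρ : IsSmallRadius h σ ρ) (hx : ‖x‖ ≤ ρ) :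
    ‖h.massForm x x‖ ≤ 1 / 4 := by
  calc ‖h.massForm x x‖ ≤ (C ^ 2 : ℝ≥0) * ‖x‖ * ‖x‖ := h.norm_massForm_le x x
    _ = C ^ 2 * ‖x‖ ^ 2 := by push_cast; ring
    _ ≤ C ^ 2 * ρ ^ 2 := by gcongr
    _ ≤ 1 / 4 := hρ.sq_mul_sq_le

theorem hasSum_termN (hρ : IsSmallRadius h σ ρ) (hx : ‖x‖ ≤ ρ) (t : ℝ) (m : ZNonzero) :
    HasSum (fun n => termN (n + 2) t (toCoeff s x) m)
      (toCoeff s (interaction h.normalSum t x) m) := by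
  have hsum := h.hasSum_termN_zero_time
    (hρ.hasSum_normalSum (propagator t x) (by rwa [norm_propagator])) m
  simp only [termN_eq_phase_mul _ t, toCoeff_interaction]
  rw [toCoeff_propagator] at hsum
  exact hsum.mul_left _

theorem hasSum_termR (hρ : IsSmallRadius h σ ρ) (hx : ‖x‖ ≤ ρ) (t : ℝ) (m : ZNonzero) :
    HasSum (fun n => termR (n + 2) t (toCoeff s x) m)
      (toCoeff s (interaction h.resonantSum t x) m) := by
  have hsum := h.hasSum_termR_zero_time
    (hρ.hasSum_normalSum (propagator t x) (by rwa [norm_propagator])) m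
  simp only [termR_eq_phase_mul _ t, toCoeff_interaction]
  rw [toCoeff_propagator] at hsum
  exact hsum.mul_left _

theorem tsum_flNorm_termN_le (hρ : IsSmallRadius h σ ρ) (hx : ‖x‖ ≤ ρ) (t : ℝ) :
    ∑' n : ℕ, flNorm s p (termN (n + 2) t (toCoeff s x)) ≤ ‖x‖ₑ := by
  have hle := hρ.tsum_truncNorm_le (toCoeff s (propagator t x)) (by
    rw [flNorm_toCoeff, enorm_le_ofReal_iff hρ.pos.le]
    rwa [norm_propagator]) 1
  simp only [truncNorm_one, toCoeff_propagator, flNorm_phase_mul, flNorm_toCoeff] at hle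
  simp only [termN_eq_phase_mul _ t, flNorm_phase_mul]
  exact hle.trans (mul_le_of_le_one_left' (by norm_num))

theorem flNorm_termR_le (hρ : IsSmallRadius h σ ρ) (hx : ‖x‖ ≤ ρ) (t : ℝ) (n : ℕ) :
    flNorm s p (termR (n + 2) t (toCoeff s x)) ≤ flNorm s p (termN (n + 1) t (toCoeff s x)) := by
  have hmass : ‖-(Complex.I / 4) * massM t (toCoeff s x)‖ₑ ≤ 1 := by
    rw [massM_eq_zero_time, ← toCoeff_propagator, h.massM_zero_toCoeff, ← ENNReal.ofReal_one,
      enorm_le_ofReal_iff zero_le_one, norm_mul, norm_neg, norm_div, Complex.norm_I,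
      Complex.norm_ofNat]
    linarith [hρ.norm_massForm_le (x := propagator t x) (by rwa [norm_propagator])]
  rw [flNorm_eq_ellNorm, flNorm_eq_ellNorm]
  refine ellNorm_mono exponent_pos.le fun k => ?_
  gcongr
  rw [termR, enorm_mul]
  exact mul_le_of_le_one_left' hmass

theorem tsum_flNorm_termR_le (hρ : IsSmallRadius h σ ρ) (hx : ‖x‖ ≤ ρ) (t : ℝ) :
    ∑' n : ℕ, flNorm s p (termR (n + 2) t (toCoeff s x)) ≤ 2 * ‖x‖ₑ :=
  calc ∑' n : ℕ, flNorm s p (termR (n + 2) t (toCoeff s x))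
      ≤ ∑' n : ℕ, flNorm s p (termN (n + 1) t (toCoeff s x)) :=
        ENNReal.tsum_le_tsum fun n => hρ.flNorm_termR_le hx t n
    _ = ‖x‖ₑ + ∑' n : ℕ, flNorm s p (termN (n + 2) t (toCoeff s x)) := by
        rw [tsum_eq_zero_add' ENNReal.summable, zero_add, flNorm_termN_one, flNorm_toCoeff]
    _ ≤ 2 * ‖x‖ₑ := by
        rw [two_mul]
        gcongr
        exact hρ.tsum_flNorm_termN_le hx t

theorem seriesConverge (hρ : IsSmallRadius h σ ρ) (hx : ‖x‖ ≤ ρ) (t : ℝ) :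
    SeriesConverge s p t (toCoeff s x) where
  summable_summandN n hn m hm := by
    obtain ⟨n, rfl⟩ := Nat.exists_eq_add_of_le' hn
    have hsum := h.summable_freqProduct (fun _ : Fin (n + 1) => propagator t x) hm
    simp only [freqProduct_apply, toCoeff_propagator] at hsum
    refine (hsum.mul_left (phase (-t) m)).congr fun k => ?_
    rw [summandN_eq_phase_mul, k.2.2]
  summable_summandM := by
    have hsum := h.summable_mul_neg (propagator t x) (propagator t x)
    simp only [toCoeff_propagator] at hsum
    exact hsum.congr fun m => (summandM_eq_phase_mul t _ m).symm
  series_termN := (hρ.tsum_flNorm_termN_le hx t).trans_lt enorm_lt_top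
  series_termR := (hρ.tsum_flNorm_termR_le hx t).trans_lt
    (ENNReal.mul_lt_top (by simp) enorm_lt_top)

end IsSmallRadius

end SmallRadius

/-! ### Truncated regularity -/

section TruncatedRegularity

variable {s p σ : ℝ} [Fact (1 ≤ p)]

/-- Multiplication of the Fourier coefficients by `min(|k|, N)^σ`. -/
def truncOp (hσ : 0 ≤ σ) (N : ℝ≥0) : SeqSpace p →L[ℂ] SeqSpace p :=
  multiplier (C := N ^ σ) (fun k => (((min ‖(k : ℂ)‖₊ N ^ σ : ℝ≥0) : ℝ) : ℂ)) fun k => by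
    rw [Complex.norm_real, NNReal.norm_eq, NNReal.coe_le_coe]
    gcongr
    exact min_le_right _ _

theorem enorm_truncOp (s : ℝ) (hσ : 0 ≤ σ) (N : ℝ≥0) (x : SeqSpace p) :
    ‖truncOp hσ N x‖ₑ = truncNorm s σ N p (toCoeff s x) := by
  have hsymbol : ∀ k : ℤ, ‖(((min ‖(k : ℂ)‖₊ N ^ σ : ℝ≥0) : ℝ) : ℂ)‖ₑ = min ‖(k : ℂ)‖ₑ N ^ σ :=
    fun k => by
      rw [enorm_eq_nnnorm (((_ : ℝ≥0) : ℝ) : ℂ), Complex.nnnorm_real, NNReal.nnnorm_eq,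
        ENNReal.coe_rpow_of_nonneg _ hσ, ENNReal.coe_min, enorm_eq_nnnorm]
  rw [← flNorm_toCoeff s, truncOp, toCoeff_multiplier, flNorm_eq_ellNorm, truncNorm]
  congr! 2 with k
  rw [enorm_mul, ← mul_assoc, truncWeight, hsymbol]

theorem truncOp_propagator (hσ : 0 ≤ σ) (N : ℝ≥0) (t : ℝ) (x : SeqSpace p) :
    truncOp hσ N (propagator t x) = propagator t (truncOp hσ N x) :=
  lp.ext (funext fun k => by simp only [truncOp, multiplier_apply, propagator_apply, mul_left_comm])

theorem norm_truncOp_interaction_le {G : SeqSpace p → SeqSpace p} {ρ c : ℝ} (hσ : 0 ≤ σ) (N : ℝ≥0)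
    (hG : ∀ x, ‖x‖ ≤ ρ → ‖truncOp hσ N (G x)‖ ≤ c * ‖truncOp hσ N x‖)
    (t : ℝ) (x : SeqSpace p) (hx : ‖x‖ ≤ ρ) :
    ‖truncOp hσ N (interaction G t x)‖ ≤ c * ‖truncOp hσ N x‖ := by
  have hle := hG (propagator t x) (by rwa [norm_propagator])
  rwa [truncOp_propagator, norm_propagator, ← norm_propagator (-t), ← truncOp_propagator] at hle

namespace IsSmallRadius

variable {C : ℝ≥0} {h : EmbedsInL2 s p C} {ρ : ℝ} {x : SeqSpace p}

theorem norm_truncOp_normalSum_le (hρ : IsSmallRadius h σ ρ) (hσ : 0 ≤ σ) (N : ℝ≥0)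
    (hx : ‖x‖ ≤ ρ) : ‖truncOp hσ N (h.normalSum x)‖ ≤ 1 / 8 * ‖truncOp hσ N x‖ := by
  have hle : ‖truncOp hσ N (h.normalSum x)‖ₑ ≤ (1 / 8 : ℝ≥0) * ‖truncOp hσ N x‖ₑ :=
    calc ‖truncOp hσ N (h.normalSum x)‖ₑ
        ≤ ∑' n : ℕ, ‖truncOp hσ N (h.normalSeries (n + 2) fun _ => x)‖ₑ := by
          rw [← ((hρ.hasSum_normalSum x hx).mapL (truncOp hσ N)).tsum_eq]
          exact enorm_tsum_le_tsum_enorm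
      _ = ∑' n : ℕ, truncNorm s σ N p (termN (n + 2) 0 (toCoeff s x)) := by
          simp only [enorm_truncOp s, EmbedsInL2.toCoeff_normalSeries]
      _ ≤ (1 / 8 : ℝ≥0) * ‖truncOp hσ N x‖ₑ := by
          rw [enorm_truncOp s]
          exact hρ.tsum_truncNorm_le _
            (by rwa [flNorm_toCoeff, enorm_le_ofReal_iff hρ.pos.le]) N
  simp only [enorm_eq_nnnorm] at hle
  exact_mod_cast hle

theorem norm_truncOp_resonantSum_le (hρ : IsSmallRadius h σ ρ) (hσ : 0 ≤ σ) (N : ℝ≥0)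
    (hx : ‖x‖ ≤ ρ) : ‖truncOp hσ N (h.resonantSum x)‖ ≤ 1 / 8 * ‖truncOp hσ N x‖ := by
  have hfactor : ‖-(Complex.I / 4) * h.massForm x x‖ ≤ 1 / 16 := by
    rw [norm_mul, norm_neg, norm_div, Complex.norm_I, Complex.norm_ofNat]
    linarith [hρ.norm_massForm_le hx]
  have hdiff : ‖truncOp hσ N (h.normalSum x) - truncOp hσ N x‖ ≤ 2 * ‖truncOp hσ N x‖ := by
    linarith [norm_sub_le (truncOp hσ N (h.normalSum x)) (truncOp hσ N x),
      hρ.norm_truncOp_normalSum_le hσ N hx, norm_nonneg (truncOp hσ N x)]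
  calc ‖truncOp hσ N (h.resonantSum x)‖
      ≤ 1 / 16 * (2 * ‖truncOp hσ N x‖) := by
        rw [EmbedsInL2.resonantSum, map_smul, map_sub, norm_smul]
        gcongr
    _ = 1 / 8 * ‖truncOp hσ N x‖ := by ring

end IsSmallRadius

end TruncatedRegularity

/-! ### Fourier coefficients of `L²` functions -/

theorem coeff_eq_repr (f : L2Torus) (k : ℤ) : coeff f k = fourierBasis.repr f k :=
  (fourierBasis_repr f k).symm

theorem coeff_sub (f g : L2Torus) : coeff (f - g) = coeff f - coeff g := by
  ext k
  simp only [Pi.sub_apply, coeff_eq_repr, map_sub]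
  rfl

theorem coeff_injective : Function.Injective coeff := by
  intro f g h
  refine fourierBasis.repr.injective (lp.ext (funext fun k => ?_))
  rw [← coeff_eq_repr, ← coeff_eq_repr, h]

theorem exists_coeff_eq {a : ℤ → ℂ} (ha : Memℓp a 2) : ∃ f : L2Torus, coeff f = a := by
  refine ⟨fourierBasis.repr.symm ⟨a, ha⟩, funext fun k => ?_⟩
  rw [coeff_eq_repr, LinearIsometryEquiv.apply_symm_apply]

theorem FL_add_subset {s p σ : ℝ} (hp : 0 < p) (hσ : 0 ≤ σ) : FL (s + σ) p ⊆ FL s p := by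
  rintro f ⟨h0, hfinite⟩
  refine ⟨h0, lt_of_le_of_lt ?_ hfinite⟩
  rw [flNorm_add_eq_iSup_truncNorm s hσ hp]
  exact (truncNorm_one s σ p _).ge.trans (le_iSup (fun N : ℝ≥0 => truncNorm s σ N p _) 1)

section Parametrization

variable {s p : ℝ} {C : ℝ≥0} [Fact (1 ≤ p)]

theorem EmbedsInL2.exists_coeff_eq_toCoeff (h : EmbedsInL2 s p C) (x : SeqSpace p) :
    ∃ f : L2Torus, coeff f = toCoeff s x := by
  refine exists_coeff_eq ?_
  have hfinite : ellNorm 2 (fun k : ZNonzero => ‖toCoeff s x k‖ₑ) < ∞ :=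
    (h.ellNorm_two_le _).trans_lt
      (ENNReal.mul_lt_top ENNReal.coe_lt_top (by rw [flNorm_toCoeff]; exact enorm_lt_top))
  have hmem := (memℓp_iff_ellNorm_lt_top two_pos).2 hfinite
  rw [ENNReal.ofReal_ofNat, memℓp_gen_iff (by norm_num)] at hmem
  refine memℓp_gen ((Function.Injective.summable_iff (g := fun k : ZNonzero => (k : ℤ))
    Subtype.val_injective fun k hk => ?_).1 hmem)
  have hk0 : k = 0 := by
    by_contra hne
    exact hk ⟨⟨k, hne⟩, rfl⟩
  simp [hk0, toCoeff_zero_freq]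

theorem exists_toCoeff_eq {f : L2Torus} (hf : f ∈ FL s p) {r : ℝ} (hr : 0 ≤ r)
    (hfr : flNorm s p (coeff f) ≤ ENNReal.ofReal r) :
    ∃ φ : SeqSpace p, toCoeff s φ = coeff f ∧ ‖φ‖ ≤ r := by
  have hφ := toCoeff_ofCoeff hf.1 hf.2
  refine ⟨_, hφ, ?_⟩
  rwa [← enorm_le_ofReal_iff hr, ← flNorm_toCoeff s, hφ]

theorem enorm_sub_eq_flNorm {x y : SeqSpace p} {f g : L2Torus} (hx : toCoeff s x = coeff f)
    (hy : toCoeff s y = coeff g) : ‖x - y‖ₑ = flNorm s p (coeff (f - g)) := by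
  rw [← flNorm_toCoeff s, map_sub, hx, hy, coeff_sub]

theorem continuousWithinAt_iff_tendsto_flNorm {x : ℝ → SeqSpace p} {v : ℝ → L2Torus} {u : Set ℝ}
    {t₀ : ℝ} (hxv : ∀ t ∈ u, toCoeff s (x t) = coeff (v t)) (ht₀ : t₀ ∈ u) :
    ContinuousWithinAt x u t₀ ↔
      Tendsto (fun t => flNorm s p (coeff (v t - v t₀))) (𝓝[u] t₀) (𝓝 0) := by
  rw [ContinuousWithinAt, tendsto_iff_edist_tendsto_0]
  refine tendsto_congr' ?_
  filter_upwards [self_mem_nhdsWithin] with t ht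
  rw [edist_eq_enorm_sub, enorm_sub_eq_flNorm (hxv t ht) (hxv t₀ ht₀)]

theorem isContinuousFL_of_continuousOn {x : ℝ → SeqSpace p} {v : ℝ → L2Torus} {T : ℝ}
    (hx : ContinuousOn x (Icc 0 T)) (hxv : ∀ t ∈ Icc 0 T, toCoeff s (x t) = coeff (v t)) :
    IsContinuousFL s p T v := by
  refine ⟨fun t ht => ⟨?_, ?_⟩, fun t₀ ht₀ =>
    (continuousWithinAt_iff_tendsto_flNorm hxv ht₀).1 (hx t₀ ht₀)⟩
  · rw [← hxv t ht, toCoeff_zero_freq]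
  · rw [← hxv t ht, flNorm_toCoeff]
    exact enorm_lt_top

theorem IsContinuousFL.exists_continuousOn {v : ℝ → L2Torus} {T : ℝ}
    (hv : IsContinuousFL s p T v) :
    ∃ x : ℝ → SeqSpace p, ContinuousOn x (Icc 0 T) ∧
      ∀ t ∈ Icc 0 T, toCoeff s (x t) = coeff (v t) := by
  choose! x hx using fun t (ht : t ∈ Icc 0 T) =>
    (⟨_, toCoeff_ofCoeff (hv.1 t ht).1 (hv.1 t ht).2⟩ :
      ∃ y : SeqSpace p, toCoeff s y = coeff (v t))
  exact ⟨x, fun t₀ ht₀ => (continuousWithinAt_iff_tendsto_flNorm hx ht₀).2 (hv.2 t₀ ht₀), hx⟩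

end Parametrization

/-! ### Solutions of the normal form equation -/

section Solutions

variable {s p : ℝ} {C : ℝ≥0} [Fact (1 ≤ p)] {h : EmbedsInL2 s p C}

/-- The right-hand side of the normal form equation with datum `φ`, for functions of time with
values in `ℓ^p(ℤ₀)`. -/
def EmbedsInL2.normalFormRhs (h : EmbedsInL2 s p C) (φ : SeqSpace p) (x : ℝ → SeqSpace p) :
    ℝ → SeqSpace p :=
  duhamel (interaction h.normalSum) (interaction h.resonantSum) φ x

namespace IsSmallRadius

variable {σ ρ : ℝ} {φ : SeqSpace p} {x : ℝ → SeqSpace p} {f : L2Torus} {v w : ℝ → L2Torus} {t : ℝ}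

theorem toCoeff_integral_resonantSum (hρ : IsSmallRadius h σ ρ) (ht : 0 ≤ t)
    (hx : ContinuousOn x (Icc 0 t)) (hxv : ∀ t' ∈ Icc 0 t, toCoeff s (x t') = coeff (v t'))
    (hxρ : ∀ t' ∈ Icc 0 t, ‖x t'‖ ≤ ρ) (m : ZNonzero) :
    toCoeff s (∫ t' in (0 : ℝ)..t, interaction h.resonantSum t' (x t')) m
      = ∫ t' in (0 : ℝ)..t, ∑' n : ℕ, termR (n + 2) t' (coeff (v t')) m := by
  rw [← coeffFunctional_apply, ← ContinuousLinearMap.intervalIntegral_comp_comm _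
    (hρ.isSmallLipschitz_resonantSum.intervalIntegrable ht hx hxρ)]
  refine intervalIntegral.integral_congr fun t' ht' => ?_
  rw [uIcc_of_le ht] at ht'
  simp only [coeffFunctional_apply, ← hxv t' ht']
  exact (hρ.hasSum_termR (hxρ t' ht') t' m).tsum_eq.symm

theorem toCoeff_normalFormRhs (hρ : IsSmallRadius h σ ρ) (hf : toCoeff s φ = coeff f)
    (hφ : ‖φ‖ ≤ ρ) (ht : 0 ≤ t) (hx : ContinuousOn x (Icc 0 t))
    (hxv : ∀ t' ∈ Icc 0 t, toCoeff s (x t') = coeff (v t'))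
    (hxρ : ∀ t' ∈ Icc 0 t, ‖x t'‖ ≤ ρ) (m : ZNonzero) :
    toCoeff s (h.normalFormRhs φ x t) m
      = coeff f m
        + ∑' n : ℕ, termN (n + 2) t (coeff (v t)) m
        - ∑' n : ℕ, termN (n + 2) 0 (coeff f) m
        + ∫ t' in (0 : ℝ)..t, ∑' n : ℕ, termR (n + 2) t' (coeff (v t')) m := by
  have htt : t ∈ Icc 0 t := right_mem_Icc.2 ht
  rw [← hρ.toCoeff_integral_resonantSum ht hx hxv hxρ, ← hxv t htt, ← hf,
    (hρ.hasSum_termN (hxρ t htt) t m).tsum_eq, (hρ.hasSum_termN hφ 0 m).tsum_eq,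
    EmbedsInL2.normalFormRhs, duhamel]
  simp only [map_add, map_sub, Pi.add_apply, Pi.sub_apply]

theorem eq_normalFormRhs_of_isSolution (hρ : IsSmallRadius h σ ρ) (hf : toCoeff s φ = coeff f)
    (hφ : ‖φ‖ ≤ ρ) (hv : IsSolution s p 1 f v) (hx : ContinuousOn x (Icc 0 1))
    (hxv : ∀ t ∈ Icc 0 1, toCoeff s (x t) = coeff (v t)) (ht : t ∈ Icc 0 1)
    (hxρ : ∀ t' ∈ Icc 0 t, ‖x t'‖ ≤ ρ) : x t = h.normalFormRhs φ x t := by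
  have hsub : Icc 0 t ⊆ Icc 0 1 := Icc_subset_Icc_right ht.2
  refine toCoeff_injective s (funext fun m => ?_)
  rcases eq_or_ne m 0 with rfl | hm
  · rw [toCoeff_zero_freq, toCoeff_zero_freq]
  · rw [hρ.toCoeff_normalFormRhs hf hφ ht.1 (hx.mono hsub) (fun t' ht' => hxv t' (hsub ht')) hxρ
      ⟨m, hm⟩, hxv t ht]
    exact hv.equation t ht m hm

theorem exists_eqOn_normalFormRhs_of_isSolution (hρ : IsSmallRadius h σ ρ)
    (hf : toCoeff s φ = coeff f) (hφ : ‖φ‖ ≤ ρ / 2) (hv : IsSolution s p 1 f v) :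
    ∃ x : ℝ → SeqSpace p, ContinuousOn x (Icc 0 1) ∧
      (∀ t ∈ Icc 0 1, toCoeff s (x t) = coeff (v t)) ∧ (∀ t ∈ Icc 0 1, ‖x t‖ ≤ ρ) ∧
      EqOn x (h.normalFormRhs φ x) (Icc 0 1) := by
  obtain ⟨x, hx, hxv⟩ := hv.continuous.exists_continuousOn
  have hφρ : ‖φ‖ ≤ ρ := by linarith [hρ.pos]
  have heq : ∀ t ∈ Icc (0 : ℝ) 1, (∀ t' ∈ Icc 0 t, ‖x t'‖ ≤ ρ) → x t = h.normalFormRhs φ x t :=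
    fun t ht => hρ.eq_normalFormRhs_of_isSolution hf hφρ hv hx hxv ht
  have hx0 : x 0 = φ := toCoeff_injective s (by rw [hxv 0 (by simp), hv.initial, hf])
  have hbound := norm_le_of_eq_duhamel hρ.pos hρ.isSmallLipschitz_normalSum
    hρ.isSmallLipschitz_resonantSum hφ hx hx0 heq
  have hxρ : ∀ t ∈ Icc (0 : ℝ) 1, ‖x t‖ ≤ ρ := fun t ht => by linarith [hbound t ht, hρ.pos]
  exact ⟨x, hx, hxv, hxρ, fun t ht => heq t ht fun t' ht' => hxρ t' ⟨ht'.1, ht'.2.trans ht.2⟩⟩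

theorem isSolution_of_eqOn_normalFormRhs (hρ : IsSmallRadius h σ ρ)
    (hf : toCoeff s φ = coeff f) (hφ : ‖φ‖ ≤ ρ) (hx : ContinuousOn x (Icc 0 1))
    (hxv : ∀ t ∈ Icc 0 1, toCoeff s (x t) = coeff (v t)) (hxρ : ∀ t ∈ Icc 0 1, ‖x t‖ ≤ ρ)
    (heq : EqOn x (h.normalFormRhs φ x) (Icc 0 1)) : IsSolution s p 1 f v where
  continuous := isContinuousFL_of_continuousOn hx hxv
  initial := by
    have h0 : (0 : ℝ) ∈ Icc (0 : ℝ) 1 := by simp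
    refine coeff_injective ?_
    rw [← hxv 0 h0, eq_of_eq_duhamel_zero hρ.isSmallLipschitz_normalSum hφ (hxρ 0 h0) (heq h0), hf]
  converge t ht := by
    rw [← hxv t ht]
    exact hρ.seriesConverge (hxρ t ht) t
  integrable := by
    have hle : ∀ t ∈ Icc (0 : ℝ) 1, ∑' n : ℕ, flNorm s p (termR (n + 2) t (coeff (v t)))
        ≤ 2 * ENNReal.ofReal ρ := fun t ht => by
      rw [← hxv t ht]
      refine (hρ.tsum_flNorm_termR_le (hxρ t ht) t).trans ?_
      gcongr
      exact (enorm_le_ofReal_iff hρ.pos.le).2 (hxρ t ht)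
    refine (setLIntegral_mono' measurableSet_Icc hle).trans_lt ?_
    rw [setLIntegral_const]
    exact ENNReal.mul_lt_top (ENNReal.mul_lt_top (by simp) ENNReal.ofReal_lt_top) (by simp)
  integrable_coeff m hm := by
    have hcont : ContinuousOn
        (fun t => coeffFunctional s ⟨m, hm⟩ (interaction h.resonantSum t (x t))) (Icc 0 1) :=
      (coeffFunctional s ⟨m, hm⟩).continuous.comp_continuousOn
        (hρ.isSmallLipschitz_resonantSum.comp_continuousOn hx hxρ)
    refine ContinuousOn.intervalIntegrable ?_
    rw [uIcc_of_le zero_le_one]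
    refine hcont.congr fun t ht => ?_
    simp only [← hxv t ht, coeffFunctional_apply]
    exact (hρ.hasSum_termR (hxρ t ht) t ⟨m, hm⟩).tsum_eq
  equation t ht m hm := by
    have hsub : Icc 0 t ⊆ Icc 0 1 := Icc_subset_Icc_right ht.2
    rw [← hρ.toCoeff_normalFormRhs hf hφ ht.1 (hx.mono hsub) (fun t' ht' => hxv t' (hsub ht'))
      (fun t' ht' => hxρ t' (hsub ht')) ⟨m, hm⟩, ← heq ht, hxv t ht]

theorem exists_isSolution (hρ : IsSmallRadius h σ ρ) (hf : f ∈ FL s p)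
    (hfρ : flNorm s p (coeff f) ≤ ENNReal.ofReal (ρ / 2)) : ∃ v, IsSolution s p 1 f v := by
  obtain ⟨φ, hφf, hφ⟩ := exists_toCoeff_eq hf (half_pos hρ.pos).le hfρ
  obtain ⟨x, hx, hxρ, heq⟩ := exists_eqOn_duhamel hρ.pos hρ.isSmallLipschitz_normalSum
    hρ.isSmallLipschitz_resonantSum hφ
  choose v hv using fun t => h.exists_coeff_eq_toCoeff (x t)
  exact ⟨v, hρ.isSolution_of_eqOn_normalFormRhs hφf (by linarith [hρ.pos]) hx.continuousOn
    (fun t _ => (hv t).symm) (fun t _ => hxρ t) heq⟩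

theorem eqOn_of_isSolution (hρ : IsSmallRadius h σ ρ) (hf : f ∈ FL s p)
    (hfρ : flNorm s p (coeff f) ≤ ENNReal.ofReal (ρ / 2)) (hv : IsSolution s p 1 f v)
    (hw : IsSolution s p 1 f w) : EqOn v w (Icc 0 1) := by
  obtain ⟨φ, hφf, hφ⟩ := exists_toCoeff_eq hf (half_pos hρ.pos).le hfρ
  obtain ⟨x, hx, hxv, hxρ, hxeq⟩ := hρ.exists_eqOn_normalFormRhs_of_isSolution hφf hφ hv
  obtain ⟨y, hy, hyw, hyρ, hyeq⟩ := hρ.exists_eqOn_normalFormRhs_of_isSolution hφf hφ hw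
  have hxy := eqOn_of_eqOn_duhamel hρ.isSmallLipschitz_normalSum
    hρ.isSmallLipschitz_resonantSum hx hy hxρ hyρ hxeq hyeq
  exact fun t ht => coeff_injective (by rw [← hxv t ht, ← hyw t ht, hxy ht])

theorem flNorm_le_of_isSolution (hρ : IsSmallRadius h σ ρ) (hσ : 0 ≤ σ) (hf : f ∈ FL s p)
    (hfρ : flNorm s p (coeff f) ≤ ENNReal.ofReal (ρ / 2)) (hv : IsSolution s p 1 f v)
    (ht : t ∈ Icc 0 1) :
    flNorm (s + σ) p (coeff (v t)) ≤ ENNReal.ofReal (3 / 2) * flNorm (s + σ) p (coeff f) := by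
  obtain ⟨φ, hφf, hφ⟩ := exists_toCoeff_eq hf (half_pos hρ.pos).le hfρ
  obtain ⟨x, hx, hxv, hxρ, hxeq⟩ := hρ.exists_eqOn_normalFormRhs_of_isSolution hφf hφ hv
  have htrunc : ∀ N : ℝ≥0, ‖truncOp hσ N (x t)‖ ≤ 3 / 2 * ‖truncOp hσ N φ‖ := fun N =>
    norm_map_le_of_eqOn_duhamel ((truncOp hσ N).restrictScalars ℝ)
      hρ.isSmallLipschitz_resonantSum
      (norm_truncOp_interaction_le hσ N fun _ => hρ.norm_truncOp_normalSum_le hσ N)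
      (norm_truncOp_interaction_le hσ N fun _ => hρ.norm_truncOp_resonantSum_le hσ N)
      le_rfl (by linarith [hρ.pos]) hx hxρ hxeq t ht
  rw [← hxv t ht, ← hφf, flNorm_add_eq_iSup_truncNorm s hσ exponent_pos,
    flNorm_add_eq_iSup_truncNorm s hσ exponent_pos, ENNReal.mul_iSup]
  refine iSup_mono fun N => ?_
  rw [← enorm_truncOp s hσ, ← enorm_truncOp s hσ, ← ofReal_norm, ← ofReal_norm,
    ← ENNReal.ofReal_mul (by norm_num)]
  exact ENNReal.ofReal_le_ofReal (htrunc N)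

end IsSmallRadius

end Solutions

end NormalForm

end

open NormalForm in
theorem mainTheorem3_general (s p : ℝ) (hp : 1 ≤ p)
    (hsp : (1 / 2 - 1 / p < s ∧ 2 < p) ∨ (0 ≤ s ∧ p ≤ 2)) :
    ∃ δ₁ : ℝ, 0 < δ₁ ∧
      (∀ φ ∈ FL s p, flNorm s p (coeff φ) ≤ ENNReal.ofReal δ₁ →
        ∃ v : ℝ → L2Torus, IsSolution s p 1 φ v ∧
          ∀ w : ℝ → L2Torus, IsSolution s p 1 φ w → Set.EqOn w v (Set.Icc 0 1)) ∧
      (∀ σ : ℝ, 0 ≤ σ → ∃ δ : ℝ, 0 < δ ∧ δ ≤ δ₁ ∧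
        ∀ φ ∈ FL (s + σ) p, flNorm s p (coeff φ) ≤ ENNReal.ofReal δ →
          ∀ v : ℝ → L2Torus, IsSolution s p 1 φ v → ∀ t ∈ Set.Icc 0 1,
            v t ∈ FL (s + σ) p ∧
            flNorm (s + σ) p (coeff (v t)) ≤
              ENNReal.ofReal (5 / 2) * flNorm (s + σ) p (coeff φ)) := by
  have : Fact (1 ≤ p) := ⟨hp⟩
  obtain ⟨C, h⟩ := exists_embedsInL2 hp hsp
  obtain ⟨ρ, hρ⟩ := (eventually_isSmallRadius h le_rfl).exists
  refine ⟨ρ / 2, half_pos hρ.pos, fun φ hφ hφρ => ?_, fun σ hσ => ?_⟩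
  · obtain ⟨v, hv⟩ := hρ.exists_isSolution hφ hφρ
    exact ⟨v, hv, fun w hw => hρ.eqOn_of_isSolution hφ hφρ hw hv⟩
  · obtain ⟨ρ', hρ', hle⟩ := ((eventually_isSmallRadius h hσ).and
      (nhdsWithin_le_nhds (eventually_le_nhds hρ.pos))).exists
    refine ⟨ρ' / 2, half_pos hρ'.pos, by linarith, fun φ hφ hφρ v hv t ht => ?_⟩
    have hbound : flNorm (s + σ) p (coeff (v t)) ≤
        ENNReal.ofReal (5 / 2) * flNorm (s + σ) p (coeff φ) := by
      have hφs : φ ∈ FL s p := FL_add_subset (by positivity) hσ hφ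
      refine (hρ'.flNorm_le_of_isSolution hσ hφs hφρ hv ht).trans ?_
      gcongr
      norm_num
    exact ⟨⟨(hv.continuous.1 t ht).1,
      hbound.trans_lt (ENNReal.mul_lt_top ENNReal.ofReal_lt_top hφ.2)⟩, hbound⟩

open NormalForm in
theorem mainTheorem3 (s p : ℝ)
    (hsp : (1 / 2 - 1 / p < s ∧ 2 < p) ∨ (0 ≤ s ∧ p = 2)) :
    ∃ δ₁ : ℝ, 0 < δ₁ ∧ ∃ T : ℝ → ℝ, (∀ r, 0 < T r) ∧
      -- existence and uniqueness
      (∀ φ ∈ FL s p, flNorm s p (coeff φ) ≤ ENNReal.ofReal δ₁ →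
        ∃ v : ℝ → L2Torus,
          IsSolution s p (T (flNorm s p (coeff φ)).toReal) φ v ∧
          ∀ w : ℝ → L2Torus, IsSolution s p (T (flNorm s p (coeff φ)).toReal) φ w →
            Set.EqOn w v (Set.Icc 0 (T (flNorm s p (coeff φ)).toReal))) ∧
      -- persistence of regularity
      (∀ σ : ℝ, 0 < σ →
        ∃ δ : ℝ, 0 < δ ∧ δ ≤ δ₁ ∧ ∃ T' : ℝ → ℝ, (∀ r, 0 < T' r ∧ T' r ≤ T r) ∧
          ∀ φ ∈ FL (s + σ) p, flNorm s p (coeff φ) ≤ ENNReal.ofReal δ →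
            ∀ v : ℝ → L2Torus,
              IsSolution s p (T (flNorm s p (coeff φ)).toReal) φ v →
              ∀ t ∈ Set.Icc 0 (T' (flNorm s p (coeff φ)).toReal),
                v t ∈ FL (s + σ) p ∧
                flNorm (s + σ) p (coeff (v t)) ≤
                  ENNReal.ofReal (5 / 2) * flNorm (s + σ) p (coeff φ)) := by
  obtain ⟨δ₁, hδ₁, hwellposed, hpersistence⟩ := mainTheorem3_general s p
    (by rcases hsp with h | h <;> linarith [h.2]) (hsp.imp_right fun h => ⟨h.1, h.2.le⟩)
  refine ⟨δ₁, hδ₁, fun _ => 1, fun _ => one_pos, hwellposed, fun σ hσ => ?_⟩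
  obtain ⟨δ, hδ, hδle, hbound⟩ := hpersistence σ hσ.le
  exact ⟨δ, hδ, hδle, fun _ => 1, fun _ => ⟨one_pos, le_rfl⟩, hbound⟩
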